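/- Let $p>3$ be a prime. For $n\ge 0$ let $A_n=\sum_{k=0}^n\binom{n}{k}^2\binom{n+k}{k}^2$ be the Apéry numbers, let $B_n(x)=\sum_{k=0}^n\binom nk B_k x^{n-k}$ be the Bernoulli polynomials (where $B_k$ are the Bernoulli numbers, $\sum_{k\ge0}B_k t^k/k!=t/(e^t-1)$), and let $\left(\frac{p}{3}\right)$ be the Legendre symbol modulo $3$, i.e. $1$ if $p\equiv1\pmod 3$ and $-1$ if $p\equiv2\pmod 3$. Then $$\frac1p\sum_{k=0}^{p-1}(-1)^k(2k+1)A_k\equiv\left(\frac p3\right)+\frac{p^2}{6}B_{p-2}\!\left(\frac13\right)\pmod{p^3},$$ where the congruence is between rational numbers whose denominators are prime to $p$: both sides are such numbers, and their difference is $p^3$ times such a number. -/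

import Mathlib

open Finset

/-- The Apéry numbers `A_n = ∑_{k=0}^n C(n,k)² C(n+k,k)²`. -/
def aperyNumber (n : ℕ) : ℕ :=
  ∑ k ∈ range (n + 1), (n.choose k) ^ 2 * ((n + k).choose k) ^ 2

/-- A rational number is `p`-integral if `p` does not divide its reduced denominator, that is, if
it lies in the localization of `ℤ` at the prime `p`. -/
def PIntegral (p : ℕ) (x : ℚ) : Prop := ¬ p ∣ x.den

/-- The congruence `a ≡ b (mod p^m)` in the ring of `p`-integral rational numbers: both sides are
`p`-integral, and their difference is `p^m` times a `p`-integral rational number. -/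
def PIntegralCongr (p m : ℕ) (a b : ℚ) : Prop :=
  PIntegral p a ∧ PIntegral p b ∧ ∃ c : ℚ, PIntegral p c ∧ a - b = (p : ℚ) ^ m * c

/-! ### Binomial identities over the integers: reduction of the Apéry sum to a double sum. -/

section ChooseIdentities

variable {R : Type*} [CommRing R]

/-! Write b_m(n) = C(n,m) C(n+m,m), so that A_n is the sum of the b_k(n)^2. Products of the b_m are
linear in the b_m (`shiftedBasis_sq`), and the sum of (-1)^k (2k+1) b_m(k) has a closed form. With
F(k,m) = (-1)^m C(m,k) C(k,m-k) this makes the left-hand side the integer S = Σ_k C(2k,k) Σ_{m<p}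
F(k,m) u_m, where u_m = (-1)^m C(p-1,m) C(p+m,m) = Π_{i≤m} (1 - p^2/i^2) ≡ 1 - p^2 H_m^{(2)} mod
p^3.

Split S into three pieces. The sum of all C(2k,k) with k < p is (p/3) plus p^2 times a sum of χ(e)
(-1)^e H_e/e. The sum of F(k,m) over all m is 1, but cutting at m < p spoils this for k > (p-1)/2 by
a multiple of p; there C(2k,k) is also a multiple of p, so the error is of order p^2. The third
piece comes from H_m^{(2)}. One certificate for F, `legendreTerm_certificate`, governs both
corrections (`sum_alternating_aperyNumber_congrPow`).

Put h = (p-1)/2. Since C(2k,k) ≡ C(h,k) (-4)^k mod p, the two double sums over central binomial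
coefficients are -2T and T for one sum T in powers of -3 (`sum_centralBinom_mul_sum_inv`).

Both T and the character sum are values of the finite dilogarithm L(w) = Σ_{i<p} w^i/i^2 at
negatives of primitive cube roots of unity w, in an algebraic closure of `ZMod p`: the character sum
by L(v) - L(1-v) = Σ v^i H_i/i, and T by a truncated form of artanh^2, because (1+w)^2 = w and
(1-w)^2 = -3w. Inversion, duplication and the cube-root distribution relation give these values.
With σ = H^{(2)} at ⌊(p-1)/3⌋ and χ = (p/3), the character sum is -χσ/3 and T is χσ/3, so S ≡ χ +
p^2 χσ/3 mod p^3.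

Finally σ is a power sum of exponent p-3 mod p, and Faulhaber's formula gives B_{p-2}(1/3) ≡ 2χσ
(`preduces_bernoulli_eval_one_third`). -/

theorem succ_mul_cast_choose_succ (n k : ℕ) :
    ((k : R) + 1) * (n.choose (k + 1) : R) = ((n : R) - k) * (n.choose k : R) := by
  rcases le_or_gt k n with h | h
  · have := congrArg (Nat.cast : ℕ → R) (Nat.choose_succ_right_eq n k)
    push_cast [Nat.cast_sub h] at this
    linear_combination this
  · simp [Nat.choose_eq_zero_of_lt h, Nat.choose_eq_zero_of_lt (h.trans (Nat.lt_succ_self k))]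

theorem sub_mul_cast_choose_succ (n k : ℕ) :
    ((n : R) + 1 - k) * ((n + 1).choose k : R) = ((n : R) + 1) * (n.choose k : R) := by
  rcases le_or_gt k (n + 1) with h | h
  · have := congrArg (Nat.cast : ℕ → R) (Nat.choose_mul_succ_eq n k)
    push_cast [Nat.cast_sub h] at this
    linear_combination -this
  · simp [Nat.choose_eq_zero_of_lt h, Nat.choose_eq_zero_of_lt ((Nat.lt_succ_self n).trans h)]

theorem succ_mul_cast_choose_succ_succ (n k : ℕ) :
    ((k : R) + 1) * ((n + 1).choose (k + 1) : R) = ((n : R) + 1) * (n.choose k : R) := by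
  have := congrArg (Nat.cast : ℕ → R) (Nat.add_one_mul_choose_eq n k)
  push_cast at this
  linear_combination -this

theorem succ_mul_cast_centralBinom (k : ℕ) :
    ((k : R) + 1) * (((2 * (k + 1)).choose (k + 1) : ℕ) : R)
      = 2 * (2 * k + 1) * ((2 * k).choose k : R) := by
  have := congrArg (Nat.cast : ℕ → R) (Nat.succ_mul_centralBinom_succ k)
  simp only [Nat.centralBinom] at this
  push_cast at this
  linear_combination this

/-- The basis `C(n,m) C(n+m,m)` of polynomials in `n (n + 1)`. -/
def shiftedBasis (n m : ℕ) : ℕ := n.choose m * (n + m).choose m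

theorem shiftedBasis_of_lt {n m : ℕ} (h : n < m) : shiftedBasis n m = 0 := by
  simp [shiftedBasis, Nat.choose_eq_zero_of_lt h]

theorem shiftedBasis_succ (n m : ℕ) :
    ((m : ℚ) + 1) ^ 2 * shiftedBasis n (m + 1)
      = ((n : ℚ) * (n + 1) - m * (m + 1)) * shiftedBasis n m := by
  have h1 := succ_mul_cast_choose_succ (R := ℚ) n m
  have h2 := succ_mul_cast_choose_succ_succ (R := ℚ) (n + m) m
  simp only [shiftedBasis, ← Nat.add_assoc]
  push_cast at h2 ⊢
  linear_combination ((m : ℚ) + 1) * ((n + m + 1).choose (m + 1) : ℚ) * h1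
    + ((n : ℚ) - m) * (n.choose m : ℚ) * h2

/-- The recurrence in l for the structure constants of the next lemma. -/
theorem shiftedBasis_mul_coeff (j l i : ℕ) :
    ((l : ℚ) + 1) ^ 2 * ((j + l + 1).choose j * (l + 1).choose (i + 1) * (j + i + 1).choose (l + 1))
      = ((j : ℚ) + i + 1) ^ 2 * ((j + l).choose j * l.choose i * (j + i).choose l)
        + (((j : ℚ) + i + 1) * (j + i + 2) - l * (l + 1))
          * ((j + l).choose j * l.choose (i + 1) * (j + i + 1).choose l) := by
  have h1 := sub_mul_cast_choose_succ (R := ℚ) (j + l) j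
  have h2 := succ_mul_cast_choose_succ (R := ℚ) (j + i + 1) l
  have h3 := sub_mul_cast_choose_succ (R := ℚ) (j + i) l
  have h4 := succ_mul_cast_choose_succ (R := ℚ) l i
  have h5 : ((l + 1).choose (i + 1) : ℚ) = l.choose i + l.choose (i + 1) := by
    exact_mod_cast Nat.choose_succ_succ l i
  rw [h5]
  push_cast at h1 h2 h3
  set a : ℚ := ((j + l + 1).choose j : ℚ)
  set b : ℚ := ((j + l).choose j : ℚ)
  set c : ℚ := ((j + i + 1).choose (l + 1) : ℚ)
  set d : ℚ := ((j + i + 1).choose l : ℚ)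
  set e : ℚ := ((j + i).choose l : ℚ)
  set u : ℚ := (l.choose i : ℚ)
  set v : ℚ := (l.choose (i + 1) : ℚ)
  linear_combination ((l : ℚ) + 1) * c * (u + v) * h1 + b * (j + l + 1) * (u + v) * h2
    + b * (j + i + 1) * u * h3 - b * d * (j + i + 1 - l) * h4

/-- Induction on l. With x = n(n+1), passing from l to l+1 multiplies by x - l(l+1). On the basis
element of index s = j+i this is x - s(s+1), which raises s by one, plus the scalar s(s+1) - l(l+1).
-/
theorem shiftedBasis_mul_shiftedBasis (n j l : ℕ) :
    (shiftedBasis n j : ℚ) * shiftedBasis n l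
      = ∑ i ∈ range (l + 1),
          ((j + l).choose j * l.choose i * (j + i).choose l : ℚ) * shiftedBasis n (j + i) := by
  induction l with
  | zero => simp [shiftedBasis]
  | succ l ih =>
    have hl : ((l : ℚ) + 1) ^ 2 ≠ 0 := by positivity
    apply mul_left_cancel₀ hl
    have h := shiftedBasis_succ n l
    calc ((l : ℚ) + 1) ^ 2 * (shiftedBasis n j * shiftedBasis n (l + 1))
        = ((n : ℚ) * (n + 1) - l * (l + 1)) * (shiftedBasis n j * shiftedBasis n l) := by
          linear_combination (shiftedBasis n j : ℚ) * h
      _ = ∑ i ∈ range (l + 1), (((j + l).choose j * l.choose i * (j + i).choose l : ℚ)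
            * (((j : ℚ) + i + 1) ^ 2 * shiftedBasis n (j + i + 1))
          + ((j + l).choose j * l.choose i * (j + i).choose l : ℚ)
            * ((((j : ℚ) + i) * (j + i + 1) - l * (l + 1)) * shiftedBasis n (j + i))) := by
          rw [ih, mul_sum]
          refine sum_congr rfl fun i _ => ?_
          have := shiftedBasis_succ n (j + i)
          push_cast at this
          rw [this]
          ring
      _ = _ := by
          rw [sum_add_distrib, sum_range_succ' (fun i => ((j + l).choose j * l.choose i *
            (j + i).choose l : ℚ) * ((((j : ℚ) + i) * (j + i + 1) - l * (l + 1))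
              * shiftedBasis n (j + i))), mul_sum, sum_range_succ' (n := l + 1), ← add_assoc]
          congr 1
          · have : ∑ i ∈ range l, ((j + l).choose j * l.choose (i + 1) * (j + (i + 1)).choose l : ℚ)
                * ((((j : ℚ) + (i + 1 : ℕ)) * (j + (i + 1 : ℕ) + 1) - l * (l + 1))
                  * shiftedBasis n (j + (i + 1)))
              = ∑ i ∈ range (l + 1),
                ((j + l).choose j * l.choose (i + 1) * (j + (i + 1)).choose l : ℚ)
                * ((((j : ℚ) + (i + 1 : ℕ)) * (j + (i + 1 : ℕ) + 1) - l * (l + 1))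
                  * shiftedBasis n (j + (i + 1))) := by
              rw [sum_range_succ]; simp
            rw [this, ← sum_add_distrib]
            refine sum_congr rfl fun i _ => ?_
            have := shiftedBasis_mul_coeff j l i
            simp only [← add_assoc]
            push_cast
            linear_combination -(shiftedBasis n (j + i + 1) : ℚ) * this
          · have h1 := sub_mul_cast_choose_succ (R := ℚ) (j + l) j
            have h2 := succ_mul_cast_choose_succ (R := ℚ) j l
            simp only [← add_assoc, add_zero, Nat.choose_zero_right]
            push_cast at h1 ⊢
            linear_combination -(((l : ℚ) + 1) * (j.choose (l + 1) : ℚ) * h1 + ((j + l).choose j : ℚ)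
              * (j + l + 1) * h2) * shiftedBasis n j

theorem sum_range_choose_mul_choose_mul {k N : ℕ} (hN : 2 * k < N) (g : ℕ → R) :
    ∑ m ∈ range N, (m.choose k * k.choose (m - k) : R) * g m
      = ∑ i ∈ range (k + 1), ((k + i).choose k * k.choose i : R) * g (k + i) := by
  have hsub : Ico k (2 * k + 1) ⊆ range N := fun x hx => by
    simp only [mem_Ico, mem_range] at *; omega
  rw [← sum_subset hsub, sum_Ico_eq_sum_range]
  · rw [show 2 * k + 1 - k = k + 1 by omega]
    exact sum_congr rfl fun i _ => by simp
  · intro m _ hm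
    simp only [mem_Ico, not_and_or, not_le, not_lt] at hm
    rcases hm with hm | hm
    · simp [Nat.choose_eq_zero_of_lt hm]
    · simp [Nat.choose_eq_zero_of_lt (show k < m - k by omega)]

theorem shiftedBasis_sq {k N : ℕ} (hN : 2 * k < N) (n : ℕ) :
    (shiftedBasis n k : ℤ) ^ 2 = ((2 * k).choose k : ℤ)
      * ∑ m ∈ range N, (m.choose k * k.choose (m - k) : ℤ) * shiftedBasis n m := by
  rw [sum_range_choose_mul_choose_mul hN]
  have := shiftedBasis_mul_shiftedBasis n k k
  have h2 : (shiftedBasis n k : ℚ) ^ 2 = ((2 * k).choose k : ℚ)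
      * ∑ i ∈ range (k + 1), ((k + i).choose k * k.choose i : ℚ) * shiftedBasis n (k + i) := by
    rw [sq, this, mul_sum]
    refine sum_congr rfl fun i _ => ?_
    rw [two_mul]; ring
  exact_mod_cast h2

/-- The weight (-1)^k (2k+1) makes the sum telescope, and the factor n+1 is what becomes p at n =
p-1. -/
theorem sum_alternating_shiftedBasis (n m : ℕ) :
    ∑ k ∈ range (n + 1), (-1 : ℤ) ^ k * (2 * k + 1) * shiftedBasis k m
      = (-1) ^ n * (n + 1) * (n.choose m * (n + 1 + m).choose m) := by
  induction n with
  | zero => rcases m with _ | m <;> simp [shiftedBasis]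
  | succ n ih =>
    rw [sum_range_succ, ih, shiftedBasis]
    have h1 := sub_mul_cast_choose_succ (R := ℤ) n m
    have h2 := sub_mul_cast_choose_succ (R := ℤ) (n + 1 + m) m
    rw [show n + 1 + 1 + m = n + 1 + m + 1 by ring]
    push_cast at h1 h2 ⊢
    linear_combination (-1 : ℤ) ^ n * (((n + 1).choose m : ℤ) * h2
      - ((n + 1 + m).choose m : ℤ) * h1)

theorem sum_alternating_aperyNumber (n : ℕ) :
    ∑ k ∈ range (n + 1), (-1 : ℤ) ^ k * (2 * k + 1) * aperyNumber k
      = (-1) ^ n * (n + 1) * ∑ k ∈ range (n + 1), ((2 * k).choose k : ℤ)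
        * ∑ m ∈ range (n + 1), (m.choose k * k.choose (m - k) : ℤ)
          * (n.choose m * (n + 1 + m).choose m) := by
  have hA : ∀ k ∈ range (n + 1), (aperyNumber k : ℤ)
      = ∑ j ∈ range (n + 1), (shiftedBasis k j : ℤ) ^ 2 := by
    intro k hk
    have hsub : range (k + 1) ⊆ range (n + 1) := by
      intro x hx; simp only [mem_range] at *; omega
    rw [← sum_subset hsub]
    · simp [aperyNumber, shiftedBasis, mul_pow]
    · intro j _ hj
      rw [shiftedBasis_of_lt (by simpa using hj)]
      simp
  -- Squares reach index 2k ≤ 2n, but the closed form contains C(n,m), so nothing survives beyond m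
  -- = n.
  have hB : ∀ k ∈ range (n + 1), ∑ m ∈ range (n + 1), (m.choose k * k.choose (m - k) : ℤ)
          * (n.choose m * (n + 1 + m).choose m)
      = ∑ m ∈ range (2 * n + 1), (m.choose k * k.choose (m - k) : ℤ)
          * (n.choose m * (n + 1 + m).choose m) := by
    intro k _
    apply sum_subset
    · intro x hx; simp only [mem_range] at *; omega
    · intro m _ hm
      rw [Nat.choose_eq_zero_of_lt (n := n) (by simpa using hm)]
      simp
  calc _ = ∑ k ∈ range (n + 1), ∑ j ∈ range (n + 1), ∑ m ∈ range (2 * n + 1),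
        ((2 * j).choose j : ℤ) * (m.choose j * j.choose (m - j) : ℤ)
          * ((-1 : ℤ) ^ k * (2 * k + 1) * shiftedBasis k m) := by
        refine sum_congr rfl fun k hk => ?_
        rw [hA k hk, mul_sum]
        refine sum_congr rfl fun j hj => ?_
        rw [shiftedBasis_sq (k := j) (N := 2 * n + 1) (by simp only [mem_range] at hj; omega),
          mul_sum, mul_sum]
        exact sum_congr rfl fun m _ => by ring
    _ = _ := by
        rw [sum_comm, mul_sum]
        refine sum_congr rfl fun j hj => ?_
        rw [hB j hj, sum_comm, mul_sum, mul_sum]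
        refine sum_congr rfl fun m _ => ?_
        rw [← mul_sum, sum_alternating_shiftedBasis]
        ring

/-- The summand `(-1)^m C(m,k) C(k,m-k)`, whose sum over `m` is `1`. -/
def legendreTerm (k m : ℕ) : ℤ := (-1) ^ m * (m.choose k * k.choose (m - k))

theorem legendreTerm_of_lt {k m : ℕ} (h : m < k) : legendreTerm k m = 0 := by
  simp [legendreTerm, Nat.choose_eq_zero_of_lt h]

theorem legendreTerm_of_two_mul_lt {k m : ℕ} (h : 2 * k < m) : legendreTerm k m = 0 := by
  simp [legendreTerm, Nat.choose_eq_zero_of_lt (show k < m - k by omega)]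

/-- A Zeilberger certificate: the difference in k is a difference in m of F(k+1,m) (3(k+1) - 2m).
Summed over all m it gives total 1; summed over m < p it leaves a boundary term; summed by parts it
handles harmonic weights. -/
theorem legendreTerm_certificate (k m : ℕ) :
    ((k : ℤ) + 1) * (legendreTerm (k + 1) m - legendreTerm k m)
      = legendreTerm (k + 1) (m + 1) * (3 * (k + 1) - 2 * (m + 1))
        - legendreTerm (k + 1) m * (3 * (k + 1) - 2 * m) := by
  rcases lt_trichotomy m k with h | rfl | h
  · rw [legendreTerm_of_lt h, legendreTerm_of_lt (by omega : m < k + 1),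
      legendreTerm_of_lt (by omega : m + 1 < k + 1)]
    ring
  · rw [legendreTerm_of_lt (by omega : m < m + 1)]
    simp [legendreTerm, pow_succ]
    ring
  · obtain ⟨i, rfl⟩ := Nat.exists_eq_add_of_lt h
    have e1 : k + i + 1 - (k + 1) = i := by omega
    have e2 : k + i + 1 - k = i + 1 := by omega
    have e3 : k + i + 1 + 1 - (k + 1) = i + 1 := by omega
    simp only [legendreTerm, e1, e2, e3]
    have h1 := succ_mul_cast_choose_succ (R := ℚ) (k + i + 1) k
    have h2 := sub_mul_cast_choose_succ (R := ℚ) (k + i + 1) (k + 1)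
    have h3 := succ_mul_cast_choose_succ (R := ℚ) (k + 1) i
    have h4 := sub_mul_cast_choose_succ (R := ℚ) k (i + 1)
    have key : ((k : ℚ) + 1) * (((-1) ^ (k + i + 1) * ((k + i + 1).choose (k + 1)
          * (k + 1).choose i)) - ((-1) ^ (k + i + 1) * ((k + i + 1).choose k * k.choose (i + 1))))
        = ((-1) ^ (k + i + 1 + 1) * ((k + i + 1 + 1).choose (k + 1) * (k + 1).choose (i + 1)))
            * (3 * (k + 1) - 2 * ((k + i + 1 : ℕ) + 1))
          - ((-1) ^ (k + i + 1) * ((k + i + 1).choose (k + 1) * (k + 1).choose i))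
            * (3 * (k + 1) - 2 * (k + i + 1 : ℕ)) := by
      have hi : (i : ℚ) + 1 ≠ 0 := by positivity
      have hk : (k : ℚ) + 1 ≠ 0 := by positivity
      push_cast at h1 h2 h3 h4 ⊢
      set u : ℚ := ((k + i + 1).choose (k + 1) : ℚ)
      set v : ℚ := ((k + 1).choose i : ℚ)
      have g1 : ((k + i + 1).choose k : ℚ) = (k + 1) * u / (i + 1) := by
        field_simp; linear_combination -h1
      have g2 : ((k + i + 1 + 1).choose (k + 1) : ℚ) = (k + i + 2) * u / (i + 1) := by
        field_simp; linear_combination h2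
      have g3 : ((k + 1).choose (i + 1) : ℚ) = (k + 1 - i) * v / (i + 1) := by
        field_simp; linear_combination h3
      have g4 : (k.choose (i + 1) : ℚ) = (k - i) * (k + 1 - i) * v / ((i + 1) * (k + 1)) := by
        rw [g3] at h4
        field_simp at h4 ⊢
        linear_combination -h4
      rw [g1, g2, g3, g4, pow_succ (-1 : ℚ) (k + i + 1)]
      field_simp
      ring
    exact_mod_cast key

theorem sum_legendreTerm_succ (k N : ℕ) :
    ((k : ℤ) + 1) * (∑ m ∈ range N, legendreTerm (k + 1) m - ∑ m ∈ range N, legendreTerm k m)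
      = legendreTerm (k + 1) N * (3 * (k + 1) - 2 * N) := by
  rw [← sum_sub_distrib, mul_sum]
  simp_rw [legendreTerm_certificate]
  have := sum_range_sub (fun m : ℕ => legendreTerm (k + 1) m * (3 * ((k : ℤ) + 1) - 2 * m)) N
  push_cast at this
  rw [this, legendreTerm_of_lt (Nat.succ_pos k)]
  ring

theorem sum_legendreTerm_eq_one {k N : ℕ} (h : 2 * k < N) :
    ∑ m ∈ range N, legendreTerm k m = 1 := by
  induction k with
  | zero =>
    rw [sum_eq_single_of_mem 0 (by simpa using h)]
    · simp [legendreTerm]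
    · intro m _ hm
      exact legendreTerm_of_two_mul_lt (by omega)
  | succ k ih =>
    have h1 := sum_legendreTerm_succ k N
    rw [legendreTerm_of_two_mul_lt h, ih (by omega), zero_mul] at h1
    have h2 : (k : ℤ) + 1 ≠ 0 := by positivity
    have := (mul_eq_zero.mp h1).resolve_left h2
    linarith

/-- The quadratic character modulo `3`. -/
def chiThree (n : ℕ) : ℤ := if n % 3 = 1 then 1 else if n % 3 = 2 then -1 else 0

theorem chiThree_add_add (n : ℕ) : chiThree n + chiThree (n + 1) + chiThree (n + 2) = 0 := by
  have : n % 3 = 0 ∨ n % 3 = 1 ∨ n % 3 = 2 := by omega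
  rcases this with h | h | h <;> simp [chiThree, Nat.add_mod, h]

theorem legendreSym_three_eq_chiThree (n : ℕ) : legendreSym 3 (n : ℤ) = chiThree n := by
  rw [legendreSym.mod]
  have : n % 3 = 0 ∨ n % 3 = 1 ∨ n % 3 = 2 := by omega
  have e : ((n : ℤ) % (3 : ℕ)) = ((n % 3 : ℕ) : ℤ) := by simp
  rw [e]
  rcases this with h | h | h <;> simp only [chiThree, h] <;> decide

/-- The shadow of 1 + ω = -ω^2: adding χ and its shift by one is minus the shift by two. -/
theorem sum_choose_mul_chiThree (n c : ℕ) :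
    ∑ k ∈ range (n + 1), (n.choose k : ℤ) * chiThree (c + k) = (-1) ^ n * chiThree (c + 2 * n) := by
  induction n generalizing c with
  | zero => simp
  | succ n ih =>
    have h : ∑ k ∈ range (n + 1 + 1), ((n + 1).choose k : ℤ) * chiThree (c + k)
        = ∑ k ∈ range (n + 1), (n.choose k : ℤ) * chiThree (c + k)
          + ∑ k ∈ range (n + 1), (n.choose k : ℤ) * chiThree (c + 1 + k) := by
      rw [sum_range_succ' _ (n + 1),
        sum_range_succ' (fun k => (n.choose k : ℤ) * chiThree (c + k)) n]
      have : ∑ k ∈ range (n + 1), ((n + 1).choose (k + 1) : ℤ) * chiThree (c + (k + 1))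
          = ∑ k ∈ range (n + 1), (n.choose k : ℤ) * chiThree (c + 1 + k)
            + ∑ k ∈ range n, (n.choose (k + 1) : ℤ) * chiThree (c + (k + 1)) := by
        have h0 : ∑ k ∈ range n, (n.choose (k + 1) : ℤ) * chiThree (c + (k + 1))
            = ∑ k ∈ range (n + 1), (n.choose (k + 1) : ℤ) * chiThree (c + (k + 1)) := by
          rw [sum_range_succ]; simp
        rw [h0, ← sum_add_distrib]
        refine sum_congr rfl fun k _ => ?_
        rw [Nat.choose_succ_succ, show c + 1 + k = c + (k + 1) by ring]
        push_cast; ring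
      rw [this]
      simp; ring
    rw [h, ih, ih]
    have := chiThree_add_add (c + 2 * n)
    rw [show c + 1 + 2 * n = c + 2 * n + 1 by ring, show c + 2 * (n + 1) = c + 2 * n + 2 by ring]
    rw [pow_succ]
    linear_combination (-1 : ℤ) ^ n * this

/-- Two applications of Pascal's rule give C(2n, n+e+1) the coefficient χ(e) + 2χ(e+1) + χ(e+2) =
χ(e+1), and the leftover term at the lower end is the new summand C(2n,n). -/
theorem sum_centralBinom (n : ℕ) :
    ∑ k ∈ range n, ((2 * k).choose k : ℤ)
      = ∑ d ∈ range n, chiThree (d + 1) * ((2 * n).choose (n + (d + 1)) : ℤ) := by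
  have ext : ∀ n N : ℕ, n ≤ N →
      ∑ d ∈ range n, chiThree (d + 1) * ((2 * n).choose (n + (d + 1)) : ℤ)
        = ∑ d ∈ range N, chiThree (d + 1) * ((2 * n).choose (n + (d + 1)) : ℤ) := by
    intro n N h
    apply sum_subset
    · intro x hx; simp only [mem_range] at *; omega
    · intro d _ hd
      simp only [mem_range, not_lt] at hd
      rw [Nat.choose_eq_zero_of_lt (by omega)]
      simp
  induction n with
  | zero => simp
  | succ n ih =>
    rw [sum_range_succ, ih, ext n (n + 3) (by omega), ext (n + 1) (n + 2) (by omega)]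
    have hp : ∀ e, ((2 * (n + 1)).choose (n + 1 + (e + 1)) : ℤ) = (2 * n).choose (n + e)
        + 2 * (2 * n).choose (n + (e + 1)) + (2 * n).choose (n + (e + 2)) := by
      intro e
      rw [show 2 * (n + 1) = 2 * n + 1 + 1 by ring, show n + 1 + (e + 1) = n + e + 1 + 1 by ring,
        Nat.choose_succ_succ, Nat.choose_succ_succ, Nat.choose_succ_succ (2 * n) (n + e + 1)]
      push_cast
      simp only [← add_assoc]
      ring
    simp_rw [hp]
    have hz : ((2 * n).choose (n + (n + 2)) : ℤ) = 0 := by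
      rw [Nat.choose_eq_zero_of_lt (by omega)]; simp
    have hz3 : ((2 * n).choose (n + (n + 3)) : ℤ) = 0 := by
      rw [Nat.choose_eq_zero_of_lt (by omega)]; simp
    have s1 : ∑ e ∈ range (n + 2), chiThree (e + 1) * ((2 * n).choose (n + e) : ℤ)
        = ∑ e ∈ range (n + 1), chiThree (e + 1 + 1) * ((2 * n).choose (n + (e + 1)) : ℤ)
          + (2 * n).choose n := by
      rw [sum_range_succ']; simp [chiThree]
    have s2 : ∑ e ∈ range (n + 2), chiThree (e + 1) * ((2 * n).choose (n + (e + 2)) : ℤ)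
        = ∑ e ∈ range (n + 3), chiThree e * ((2 * n).choose (n + (e + 1)) : ℤ) := by
      rw [sum_range_succ' _ (n + 2)]; simp [chiThree, add_assoc]
    simp only [mul_add, sum_add_distrib]
    rw [s1, s2]
    simp only [sum_range_succ _ (n + 2), sum_range_succ _ (n + 1), hz, hz3, mul_zero, add_zero]
    have : ∑ d ∈ range (n + 1), chiThree (d + 1) * ((2 * n).choose (n + (d + 1)) : ℤ)
        = ∑ e ∈ range (n + 1), chiThree (e + 1 + 1) * ((2 * n).choose (n + (e + 1)) : ℤ)
          + ∑ e ∈ range (n + 1), chiThree e * ((2 * n).choose (n + (e + 1)) : ℤ)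
          + ∑ e ∈ range (n + 1), chiThree (e + 1) * (2 * ((2 * n).choose (n + (e + 1)) : ℤ)) := by
      rw [← sum_add_distrib, ← sum_add_distrib]
      refine sum_congr rfl fun e _ => ?_
      have := chiThree_add_add e
      linear_combination -((2 * n).choose (n + (e + 1)) : ℤ) * this
    linarith

end ChooseIdentities

/-! ### Leading p-adic terms of binomial coefficients. -/

section LeadingTerms

/-- `p ^ n` divides `a`, and the quotient reduces to `x` modulo `p`. -/
def CongrPow (p n : ℕ) (a : ℤ) (x : ZMod p) : Prop :=
  ∃ c : ℤ, a = (p : ℤ) ^ n * c ∧ (c : ZMod p) = x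

namespace CongrPow

variable {p n m : ℕ} {a b : ℤ} {x y : ZMod p}

theorem add (ha : CongrPow p n a x) (hb : CongrPow p n b y) : CongrPow p n (a + b) (x + y) := by
  obtain ⟨c, rfl, rfl⟩ := ha
  obtain ⟨d, rfl, rfl⟩ := hb
  exact ⟨c + d, by ring, by push_cast; rfl⟩

theorem sub (ha : CongrPow p n a x) (hb : CongrPow p n b y) : CongrPow p n (a - b) (x - y) := by
  obtain ⟨c, rfl, rfl⟩ := ha
  obtain ⟨d, rfl, rfl⟩ := hb
  exact ⟨c - d, by ring, by push_cast; rfl⟩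

theorem mul (ha : CongrPow p n a x) (hb : CongrPow p m b y) :
    CongrPow p (n + m) (a * b) (x * y) := by
  obtain ⟨c, rfl, rfl⟩ := ha
  obtain ⟨d, rfl, rfl⟩ := hb
  exact ⟨c * d, by ring, by push_cast; rfl⟩

theorem int_mul (u : ℤ) (ha : CongrPow p n a x) : CongrPow p n (u * a) (u * x) := by
  obtain ⟨c, rfl, rfl⟩ := ha
  exact ⟨u * c, by ring, by push_cast; rfl⟩

theorem prime_mul (ha : CongrPow p n a x) : CongrPow p (n + 1) (p * a) x := by
  obtain ⟨c, rfl, rfl⟩ := ha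
  exact ⟨c, by ring, rfl⟩

theorem zero : CongrPow p n 0 0 := ⟨0, by simp, by simp⟩

theorem of_cast_eq (h : (a : ZMod p) = x) : CongrPow p 0 a x := ⟨a, by simp, h⟩

theorem sum {ι : Type*} {s : Finset ι} {f : ι → ℤ} {g : ι → ZMod p}
    (h : ∀ i ∈ s, CongrPow p n (f i) (g i)) : CongrPow p n (∑ i ∈ s, f i) (∑ i ∈ s, g i) := by
  classical
  induction s using Finset.induction_on with
  | empty => simpa using zero
  | insert i s hi ih =>
    rw [sum_insert hi, sum_insert hi]
    exact (h i (mem_insert_self i s)).add (ih fun j hj => h j (mem_insert_of_mem hj))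

theorem of_int_mul [Fact p.Prime] {u : ℤ} (hu : (u : ZMod p) ≠ 0)
    (ha : CongrPow p n (u * a) (u * x)) : CongrPow p n a x := by
  obtain ⟨c, hc, hx⟩ := ha
  have hp : Prime (p : ℤ) := Nat.prime_iff_prime_int.mp Fact.out
  have hcop : IsCoprime ((p : ℤ) ^ n) u := by
    refine IsCoprime.pow_left ((Prime.coprime_iff_not_dvd hp).mpr ?_)
    rwa [ne_eq, ZMod.intCast_zmod_eq_zero_iff_dvd] at hu
  obtain ⟨d, rfl⟩ := hcop.dvd_of_dvd_mul_left ⟨c, hc⟩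
  refine ⟨d, rfl, ?_⟩
  have h1 : (p : ℤ) ^ n * (u * d) = (p : ℤ) ^ n * c := by rw [← hc]; ring
  have h2 : u * d = c := mul_left_cancel₀ (pow_ne_zero _ hp.ne_zero) h1
  rw [← h2] at hx
  push_cast at hx
  exact mul_left_cancel₀ hu hx

end CongrPow

/-- `∑_{i=1}^m i^{-r}` in a field. -/
def harmonicSum (K : Type*) [Field K] (r m : ℕ) : K := ∑ i ∈ range m, (((i : K) + 1) ^ r)⁻¹

theorem harmonicSum_succ (K : Type*) [Field K] (r m : ℕ) :
    harmonicSum K r (m + 1) = harmonicSum K r m + (((m : K) + 1) ^ r)⁻¹ := sum_range_succ _ _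

variable {p : ℕ} [hpf : Fact p.Prime]

theorem cast_ne_zero_of_lt {k : ℕ} (h0 : 0 < k) (hk : k < p) : (k : ZMod p) ≠ 0 := by
  rw [ne_eq, ZMod.natCast_eq_zero_iff]
  exact Nat.not_dvd_of_pos_of_lt h0 hk

theorem cast_succ_ne_zero_of_lt {k : ℕ} (hk : k + 1 < p) : (k : ZMod p) + 1 ≠ 0 := by
  exact_mod_cast cast_ne_zero_of_lt (Nat.succ_pos k) hk

/-- The product equals Π_{i≤m} (1 - p^2/i^2). -/
theorem congrPow_alternating_choose_mul_choose {n : ℕ} (hn : n + 1 = p) {m : ℕ} (hm : m < p) :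
    CongrPow p 2 ((-1) ^ m * (n.choose m * (n + 1 + m).choose m) - 1) (-harmonicSum (ZMod p) 2 m) := by
  induction m with
  | zero => simpa [harmonicSum] using CongrPow.zero
  | succ m ih =>
    have hne := cast_succ_ne_zero_of_lt hm
    have ih := ih (by omega)
    have hpn : (p : ℤ) = n + 1 := by exact_mod_cast hn.symm
    apply CongrPow.of_int_mul (u := ((m : ℤ) + 1) ^ 2) (by push_cast; exact pow_ne_zero _ hne)
    have h1 := succ_mul_cast_choose_succ (R := ℤ) n m
    have h2 := succ_mul_cast_choose_succ_succ (R := ℤ) (n + 1 + m) m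
    have e : ((m : ℤ) + 1) ^ 2 * ((-1) ^ (m + 1) * (n.choose (m + 1)
          * (n + 1 + (m + 1)).choose (m + 1)) - 1)
        = ((m : ℤ) + 1) ^ 2 * ((-1) ^ m * (n.choose m * (n + 1 + m).choose m) - 1)
          - p * (p * (((-1) ^ m * (n.choose m * (n + 1 + m).choose m) - 1) + 1)) := by
      rw [show n + 1 + (m + 1) = n + 1 + m + 1 by ring, pow_succ, hpn]
      push_cast at h1 h2 ⊢
      linear_combination -(-1 : ℤ) ^ m * ((n + 1 + m + 1).choose (m + 1) * (m + 1) * h1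
        + (n - m) * (n.choose m) * h2)
    rw [e]
    have h3 : CongrPow p 0 (((-1) ^ m * (n.choose m * (n + 1 + m).choose m) - 1) + 1) (0 + 1) := by
      refine CongrPow.add (CongrPow.of_cast_eq ?_) (CongrPow.of_cast_eq (by simp))
      obtain ⟨c, hc, -⟩ := ih
      rw [hc]; simp
    have h4 := (ih.int_mul (((m : ℤ) + 1) ^ 2)).sub h3.prime_mul.prime_mul
    convert h4 using 1
    rw [harmonicSum_succ]
    push_cast
    field_simp
    ring

/-- C(ap-1,j) = (-1)^j Π_{i≤j} (1 - ap/i). The cases a = 1 and a = 2 are compared later. -/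
theorem congrPow_choose_sub {a N : ℕ} (hN : N + 1 = a * p) {j : ℕ} (hj : j < p) :
    CongrPow p 1 ((N.choose j : ℤ) - (-1) ^ j) (-(a * (-1) ^ j * harmonicSum (ZMod p) 1 j)) := by
  induction j with
  | zero => simpa [harmonicSum] using CongrPow.zero
  | succ j ih =>
    have hne := cast_succ_ne_zero_of_lt hj
    have ih := ih (by omega)
    have hpn : (a : ℤ) * p = N + 1 := by exact_mod_cast hN.symm
    apply CongrPow.of_int_mul (u := (j : ℤ) + 1) (by push_cast; exact hne)
    have h1 := succ_mul_cast_choose_succ (R := ℤ) N j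
    have e : ((j : ℤ) + 1) * (N.choose (j + 1) - (-1) ^ (j + 1))
        = a * (p * (N.choose j - (-1) ^ j + (-1) ^ j)) - (j + 1) * (N.choose j - (-1) ^ j) := by
      rw [pow_succ]
      linear_combination h1 - (N.choose j : ℤ) * hpn
    rw [e]
    have h3 : CongrPow p 0 ((N.choose j : ℤ) - (-1) ^ j + (-1) ^ j) (0 + (-1) ^ j) := by
      refine CongrPow.add (CongrPow.of_cast_eq ?_) (CongrPow.of_cast_eq (by simp))
      obtain ⟨c, hc, -⟩ := ih
      rw [hc]; simp
    have h4 := (h3.prime_mul.int_mul a).sub (ih.int_mul ((j : ℤ) + 1))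
    convert h4 using 1
    rw [harmonicSum_succ, pow_succ]
    push_cast
    field_simp
    ring

theorem cast_choose_eq {a N : ℕ} (hN : N + 1 = a * p) {j : ℕ} (hj : j < p) :
    (N.choose j : ZMod p) = (-1) ^ j := by
  obtain ⟨c, hc, -⟩ := congrPow_choose_sub hN hj
  have := congrArg (Int.cast : ℤ → ZMod p) hc
  push_cast at this
  simp at this
  linear_combination this

theorem cast_choose_sub_eq {i j : ℕ} (hi : i + 1 ≤ p) (hj : j < p) :
    ((p - (i + 1)).choose j : ZMod p) = (-1) ^ j * (i + j).choose j := by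
  induction j with
  | zero => simp
  | succ j ih =>
    have hne := cast_succ_ne_zero_of_lt hj
    apply mul_left_cancel₀ hne
    have h1 := succ_mul_cast_choose_succ (R := ZMod p) (p - (i + 1)) j
    have h2 := succ_mul_cast_choose_succ_succ (R := ZMod p) (i + j) j
    rw [h1, ih (by omega), ← add_assoc i j 1, Nat.cast_sub hi]
    push_cast at h2 ⊢
    rw [CharP.cast_eq_zero, pow_succ]
    linear_combination (-1) ^ j * h2

theorem centralBinom_cast_eq_zero {h k : ℕ} (hp : p = 2 * h + 1) (hk : h < k) (hkp : k < p) :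
    ((2 * k).choose k : ZMod p) = 0 := by
  rw [ZMod.natCast_eq_zero_iff]
  exact hpf.out.dvd_choose hkp (by omega) (by omega)

theorem centralBinom_cast_ne_zero {h k : ℕ} (hp : p = 2 * h + 1) (hk : k ≤ h) :
    ((2 * k).choose k : ZMod p) ≠ 0 := by
  rw [ne_eq, ZMod.natCast_eq_zero_iff]
  intro hd
  have h1 : p ∣ (2 * k).factorial := hd.trans
    ⟨k.factorial * (2 * k - k).factorial, by
      rw [← mul_assoc, Nat.choose_mul_factorial_mul_factorial (by omega)]⟩
  have := (hpf.out.dvd_factorial).mp h1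
  omega

theorem two_ne_zero_of_odd {h : ℕ} (hp : p = 2 * h + 1) : (2 : ZMod p) ≠ 0 := by
  have := hpf.out.two_le
  have h2 : 2 < p := by omega
  exact_mod_cast cast_ne_zero_of_lt (by norm_num : 0 < 2) h2

theorem sum_inv_pow_reflect {h : ℕ} (hp : p = 2 * h + 1) {e : ℕ} (he : e < p) :
    harmonicSum (ZMod p) 1 (p - 1 - e) = harmonicSum (ZMod p) 1 e := by
  induction e with
  | zero =>
    have h2 := two_ne_zero_of_odd hp
    have h3 : harmonicSum (ZMod p) 1 (p - 1) = -harmonicSum (ZMod p) 1 (p - 1) := by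
      conv_lhs => rw [harmonicSum, ← sum_range_reflect]
      rw [harmonicSum, ← sum_neg_distrib]
      refine sum_congr rfl fun i hi => ?_
      have hi' : i + 1 < p := by simp only [mem_range] at hi; omega
      rw [show p - 1 - 1 - i = p - (i + 2) by omega, Nat.cast_sub (by omega)]
      push_cast
      rw [CharP.cast_eq_zero, pow_one, pow_one, neg_inv]
      congr 1; ring
    have h4 : 2 * harmonicSum (ZMod p) 1 (p - 1) = 0 := by linear_combination h3
    simpa [harmonicSum] using (mul_eq_zero.mp h4).resolve_left h2
  | succ e ih =>
    have ih := ih (by omega)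
    rw [show p - 1 - e = p - 1 - (e + 1) + 1 by omega, harmonicSum_succ] at ih
    rw [harmonicSum_succ, ← ih, show p - 1 - (e + 1) = p - (e + 2) by omega,
      Nat.cast_sub (by omega), add_assoc, left_eq_add]
    push_cast
    rw [CharP.cast_eq_zero, pow_one, pow_one,
      show (0 - ((e : ZMod p) + 2) + 1) = -((e : ZMod p) + 1) by ring, inv_neg]
    ring

/-- This inverts C(2l,l) modulo p: C(2(p-l),p-l) ≡ -2p/(l C(2l,l)) mod p^2. In the induction two
consecutive products differ by p times a combination of central coefficients that are themselves
divisible by p. -/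
theorem congrPow_centralBinom_reflect {h : ℕ} (hp : p = 2 * h + 1) {l : ℕ} (h0 : 1 ≤ l) (hl : l ≤ h) :
    CongrPow p 1 ((l * (2 * l).choose l : ℤ) * ((2 * (p - l)).choose (p - l) : ℤ)) (-2) := by
  induction l, h0 using Nat.le_induction with
  | base =>
    obtain ⟨q, rfl⟩ : ∃ q, p = q + 1 := ⟨p - 1, by omega⟩
    have h1 := succ_mul_cast_choose_succ_succ (R := ℤ) (2 * q) q
    have h2 := cast_choose_eq (p := q + 1) (a := 2) (N := 2 * q + 1) (j := q) (by ring) (by omega)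
    have hq : Even q := ⟨h, by omega⟩
    rw [hq.neg_one_pow] at h2
    have h3 : (2 * q + 1).choose (q + 1) = (2 * q + 1).choose q :=
      Nat.choose_symm_of_eq_add (by ring)
    have h4 : CongrPow (q + 1) 1 ((2 * q + 1) * ((2 * q).choose q : ℤ)) 1 := by
      push_cast at h1
      rw [← h1, h3]
      have := (CongrPow.of_cast_eq (p := q + 1) (a := ((2 * q + 1).choose q : ℤ)) (x := 1)
        (by simpa using h2)).prime_mul
      simpa using this
    have hq1 : (q : ZMod (q + 1)) = -1 := by
      have := CharP.cast_eq_zero (ZMod (q + 1)) (q + 1)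
      push_cast at this
      linear_combination this
    apply CongrPow.of_int_mul (u := 2 * q + 1)
    · push_cast; rw [hq1]; norm_num
    · have := h4.int_mul 2
      rw [Nat.add_sub_cancel]
      convert this using 1
      · simp; ring
      · push_cast; rw [hq1]; ring
  | succ l h0 ih =>
    have ih := ih (by omega)
    obtain ⟨k, hk⟩ : ∃ k, p = l + 1 + k := ⟨p - (l + 1), by omega⟩
    rw [show p - l = k + 1 by omega] at ih
    rw [show p - (l + 1) = k by omega]
    have h1 := succ_mul_cast_centralBinom (R := ℤ) l
    have h2 := succ_mul_cast_centralBinom (R := ℤ) k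
    have hpk : (p : ℤ) = l + 1 + k := by exact_mod_cast hk
    have z1 : CongrPow p 0 ((2 * k).choose k : ℤ) 0 :=
      CongrPow.of_cast_eq (by simpa using centralBinom_cast_eq_zero hp (by omega) (by omega))
    have z2 : CongrPow p 0 ((2 * (k + 1)).choose (k + 1) : ℤ) 0 :=
      CongrPow.of_cast_eq (by simpa using centralBinom_cast_eq_zero hp (by omega) (by omega))
    have := ih.add (((z1.int_mul 4).sub z2).int_mul ((2 * l).choose l)).prime_mul
    convert this using 1
    · push_cast at h1 h2 ⊢
      rw [hpk]
      linear_combination ((2 * k).choose k : ℤ) * h1 + ((2 * l).choose l : ℤ) * h2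
    · simp

end LeadingTerms

/-! ### The three corrections of order p^2. -/

section LegendreSums

variable {p : ℕ} [hpf : Fact p.Prime]

/-- The jump is the boundary term of the certificate at m = p. Its factor C(p,k+1) supplies one p,
and with k+1 = p-(i+1) the other binomial reduces to half of a central one. -/
theorem congrPow_sum_legendreTerm_sub {h : ℕ} (hp : p = 2 * h + 1) {i k : ℕ}
    (hk : k + (i + 1) + 1 = p) :
    CongrPow p 1 (∑ m ∈ range p, legendreTerm (k + 1) m - ∑ m ∈ range p, legendreTerm k m)
      (3 / 2 * (((2 * (i + 1)).choose (i + 1) : ZMod p) / ((i : ZMod p) + 1))) := by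
  have h2 := two_ne_zero_of_odd hp
  have hi0 : (i : ZMod p) + 1 ≠ 0 := cast_succ_ne_zero_of_lt (by omega)
  have hki : (k : ZMod p) + 1 = -((i : ZMod p) + 1) := by
    have h := CharP.cast_eq_zero (ZMod p) p
    have h' : (p : ZMod p) = k + (i + 1) + 1 := by exact_mod_cast congrArg (Nat.cast (R := ZMod p)) hk.symm
    linear_combination h - h'
  have hk0 : (k : ZMod p) + 1 ≠ 0 := by rw [hki]; exact neg_ne_zero.mpr hi0
  have h1 := sum_legendreTerm_succ k p
  have hodd : Odd p := ⟨h, hp⟩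
  obtain ⟨q, rfl⟩ : ∃ q, p = q + 1 := ⟨p - 1, by omega⟩
  have hq : Even q := ⟨h, by omega⟩
  have e1 : q + 1 - (k + 1) = i + 1 := by omega
  have h3 := succ_mul_cast_choose_succ_succ (R := ℤ) q k
  have h4 := cast_choose_eq (p := q + 1) (a := 1) (N := q) (j := k) (by ring) (by omega)
  have h5 := cast_choose_sub_eq (p := q + 1) (i := i) (j := i + 1) (by omega) (by omega)
  rw [show q + 1 - (i + 1) = k + 1 by omega, show i + (i + 1) = 2 * i + 1 by ring] at h5
  have h6 : ((2 * (i + 1)).choose (i + 1) : ZMod (q + 1)) = 2 * (2 * i + 1).choose (i + 1) := by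
    have e : (2 * (i + 1)).choose (i + 1) = 2 * (2 * i + 1).choose (i + 1) := by
      rw [show 2 * (i + 1) = 2 * i + 1 + 1 by ring, Nat.choose_succ_succ,
        Nat.choose_symm_of_eq_add (show 2 * i + 1 = i + (i + 1) by ring)]
      ring
    rw [e]; push_cast; rfl
  have hsign : (-1 : ZMod (q + 1)) ^ k * (-1) ^ (i + 1) = 1 := by
    rw [← pow_add, show k + (i + 1) = q by omega, hq.neg_one_pow]
  apply CongrPow.of_int_mul (u := ((k : ℤ) + 1) ^ 2)
    (by push_cast; exact pow_ne_zero _ hk0)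
  have e : ((k : ℤ) + 1) ^ 2 * (∑ m ∈ range (q + 1), legendreTerm (k + 1) m
        - ∑ m ∈ range (q + 1), legendreTerm k m)
      = (q + 1 : ℕ) * (-(q.choose k : ℤ) * ((k + 1).choose (i + 1))
          * (3 * (k + 1) - 2 * (q + 1 : ℕ))) := by
    have : legendreTerm (k + 1) (q + 1)
        = -((q + 1).choose (k + 1) * (k + 1).choose (i + 1)) := by
      rw [legendreTerm, hodd.neg_one_pow, e1]; ring
    rw [this] at h1
    push_cast at h1 ⊢
    linear_combination ((k : ℤ) + 1) * h1
      - ((k + 1).choose (i + 1) : ℤ) * (3 * (k + 1) - 2 * (q + 1)) * h3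
  rw [e]
  apply CongrPow.prime_mul (n := 0)
  apply CongrPow.of_cast_eq
  have hq0 := CharP.cast_eq_zero (ZMod (q + 1)) (q + 1)
  push_cast at hq0 ⊢
  rw [h4, h5, h6, hki, hq0]
  field_simp
  linear_combination 3 * ((2 * i + 1).choose (i + 1) : ZMod (q + 1)) * (i + 1) * hsign


theorem congrPow_sum_legendreTerm {h : ℕ} (hp : p = 2 * h + 1) {d : ℕ} (hd : d ≤ h) :
    CongrPow p 1 (∑ m ∈ range p, legendreTerm (h + d) m - 1)
      (3 / 2 * ∑ i ∈ Ico (h + 1 - d) (h + 1), ((2 * i).choose i : ZMod p) / i) := by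
  induction d with
  | zero =>
    rw [add_zero, sum_legendreTerm_eq_one (by omega)]
    simpa using CongrPow.zero
  | succ d ih =>
    have h1 := congrPow_sum_legendreTerm_sub hp (i := h - d - 1) (k := h + d) (by omega)
    have h2 := h1.add (ih (by omega))
    rw [show h + 1 - (d + 1) = h - d by omega, sum_eq_sum_Ico_succ_bot (by omega),
      show h - d + 1 = h + 1 - d by omega]
    convert h2 using 1
    · ring_nf
    · rw [show h - d - 1 + 1 = h - d by omega,
        show ((h - d - 1 : ℕ) : ZMod p) + 1 = (h - d : ℕ) by
          rw [show h - d = h - d - 1 + 1 by omega]; push_cast; simp]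
      ring

/-- Only k = p-l with 1 ≤ l ≤ h contributes; each such term is a product of two multiples of p with
known leading coefficients. -/
theorem sum_centralBinom_mul_sub {h : ℕ} (hp : p = 2 * h + 1) :
    CongrPow p 2 (∑ k ∈ range p, ((2 * k).choose k : ℤ) * (∑ m ∈ range p, legendreTerm k m - 1))
      (-3 * ∑ l ∈ Ico 1 (h + 1), 1 / (l * (2 * l).choose l : ZMod p)
        * ∑ i ∈ Ico l (h + 1), ((2 * i).choose i : ZMod p) / i) := by
  have h2 := two_ne_zero_of_odd hp
  have e : ∑ k ∈ range p, ((2 * k).choose k : ℤ) * (∑ m ∈ range p, legendreTerm k m - 1)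
      = ∑ l ∈ Ico 1 (h + 1), ((2 * (p - l)).choose (p - l) : ℤ)
          * (∑ m ∈ range p, legendreTerm (p - l) m - 1) := by
    rw [sum_Ico_reflect (fun k => ((2 * k).choose k : ℤ) * (∑ m ∈ range p, legendreTerm k m - 1))
      1 (by omega : h + 1 ≤ p + 1), range_eq_Ico,
      ← sum_Ico_consecutive _ (Nat.zero_le (h + 1)) (by omega : h + 1 ≤ p),
      show p + 1 - (h + 1) = h + 1 by omega, Nat.add_sub_cancel, add_eq_right]
    refine sum_eq_zero fun k hk => ?_
    rw [← range_eq_Ico, sum_legendreTerm_eq_one (by simp only [mem_Ico] at hk; omega)]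
    simp
  rw [e, mul_sum]
  apply CongrPow.sum
  intro l hl
  simp only [mem_Ico] at hl
  have hl0 : (l : ZMod p) ≠ 0 := cast_ne_zero_of_lt (by omega) (by omega)
  have hc := centralBinom_cast_ne_zero hp (by omega : l ≤ h)
  have h1 := congrPow_centralBinom_reflect hp hl.1 (by omega)
  have h3 : CongrPow p 1 ((2 * (p - l)).choose (p - l) : ℤ) (-2 / (l * (2 * l).choose l)) := by
    apply CongrPow.of_int_mul (u := (l * (2 * l).choose l : ℤ))
      (by push_cast; exact mul_ne_zero hl0 hc)
    convert h1 using 1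
    push_cast
    field_simp
  have h4 := congrPow_sum_legendreTerm hp (d := h + 1 - l) (by omega)
  rw [show h + (h + 1 - l) = p - l by omega, show h + 1 - (h + 1 - l) = l by omega] at h4
  convert h3.mul h4 using 1
  field_simp

/-- C(2p,p+e) agrees with 2 C(p,e) modulo p^2, and the sum of χ(e) C(p,e) over 0 < e < p is zero
because the full binomial sum is -χ(2p) = χ(p), its own last term. -/
theorem sum_centralBinom_congrPow {h : ℕ} (hp : p = 2 * h + 1) :
    CongrPow p 2 (∑ k ∈ range p, ((2 * k).choose k : ℤ) - chiThree p)
      (2 * ∑ e ∈ Ico 1 p, (chiThree e : ZMod p) * (-1) ^ e * harmonicSum (ZMod p) 1 e / e) := by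
  have hodd : Odd p := ⟨h, hp⟩
  have hchi : -chiThree (2 * p) = chiThree p := by
    have : p % 3 = 0 ∨ p % 3 = 1 ∨ p % 3 = 2 := by omega
    rcases this with h | h | h <;> simp [chiThree, Nat.mul_mod, h]
  have h1 := sum_choose_mul_chiThree p 0
  rw [hodd.neg_one_pow] at h1
  simp only [zero_add] at h1
  rw [sum_range_succ, Nat.choose_self, range_eq_Ico, sum_eq_sum_Ico_succ_bot hpf.out.pos] at h1
  have h0 : chiThree 0 = 0 := rfl
  have h2 : ∑ k ∈ Ico 1 p, (p.choose k : ℤ) * chiThree k = 0 := by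
    rw [h0] at h1
    push_cast at h1
    linarith
  have h3 : ∑ k ∈ range p, ((2 * k).choose k : ℤ) - chiThree p
      = ∑ e ∈ Ico 1 p, chiThree e * ((2 * p).choose (p + e) - 2 * p.choose e : ℤ) := by
    rw [sum_centralBinom]
    have e1 : ∑ d ∈ range p, chiThree (d + 1) * ((2 * p).choose (p + (d + 1)) : ℤ)
        = ∑ d ∈ Ico 1 (p + 1), chiThree d * ((2 * p).choose (p + d) : ℤ) := by
      rw [range_eq_Ico, sum_Ico_add' (fun d => chiThree d * ((2 * p).choose (p + d) : ℤ))]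
    rw [e1, sum_Ico_succ_top hpf.out.one_le, ← two_mul, Nat.choose_self]
    have e2 : ∑ e ∈ Ico 1 p, chiThree e * ((2 * p).choose (p + e) - 2 * p.choose e : ℤ)
        = ∑ d ∈ Ico 1 p, chiThree d * ((2 * p).choose (p + d) : ℤ)
          - 2 * ∑ k ∈ Ico 1 p, (p.choose k : ℤ) * chiThree k := by
      rw [mul_sum, ← sum_sub_distrib]
      exact sum_congr rfl fun e _ => by ring
    rw [e2, h2]
    push_cast
    ring
  rw [h3, mul_sum]
  apply CongrPow.sum
  intro e he
  simp only [mem_Ico] at he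
  have he0 : (e : ZMod p) ≠ 0 := cast_ne_zero_of_lt (by omega) he.2
  obtain ⟨j, hj⟩ : ∃ j, p = j + 1 + e := ⟨p - 1 - e, by omega⟩
  have hje : (j : ZMod p) + 1 = -e := by
    have h := CharP.cast_eq_zero (ZMod p) p
    have h' : (p : ZMod p) = j + 1 + e := by exact_mod_cast congrArg (Nat.cast (R := ZMod p)) hj
    linear_combination h - h'
  have hH : harmonicSum (ZMod p) 1 j = harmonicSum (ZMod p) 1 e := by
    rw [← sum_inv_pow_reflect hp he.2]; congr 1; omega
  have hs : (-1 : ZMod p) ^ j = (-1) ^ e := by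
    have : Even (j + e) := ⟨h, by omega⟩
    have h5 : (-1 : ZMod p) ^ j * (-1) ^ e = 1 := by rw [← pow_add, this.neg_one_pow]
    have h6 : (-1 : ZMod p) ^ e * (-1) ^ e = 1 := by rw [← mul_pow]; simp
    linear_combination (-1 : ZMod p) ^ e * h5 - (-1 : ZMod p) ^ j * h6
  -- Multiplied by j+1 = p-e, the difference becomes 2p (C(2p-1,j) - C(p-1,j)), whose bracket is
  -- again a multiple of p.
  have key : CongrPow p 2 ((2 * p).choose (p + e) - 2 * p.choose e : ℤ)
      (2 * ((-1) ^ e * harmonicSum (ZMod p) 1 e / e)) := by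
    apply CongrPow.of_int_mul (u := (j : ℤ) + 1) (by push_cast; rw [hje]; exact neg_ne_zero.mpr he0)
    have c1 := succ_mul_cast_choose_succ_succ (R := ℤ) (2 * p - 1) j
    have c2 := succ_mul_cast_choose_succ_succ (R := ℤ) (p - 1) j
    have hp1 := hpf.out.one_le
    rw [show 2 * p - 1 + 1 = 2 * p by omega, Nat.cast_sub (by omega)] at c1
    rw [show p - 1 + 1 = p by omega, Nat.cast_sub (by omega)] at c2
    rw [Nat.choose_symm_of_eq_add (show 2 * p = p + e + (j + 1) by omega),
      Nat.choose_symm_of_eq_add (show p = e + (j + 1) by omega)]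
    have d1 := congrPow_choose_sub (p := p) (a := 2) (N := 2 * p - 1) (j := j) (by omega) (by omega)
    have d2 := congrPow_choose_sub (p := p) (a := 1) (N := p - 1) (j := j) (by omega) (by omega)
    have d3 := ((d1.sub d2).int_mul 2).prime_mul
    convert d3 using 1
    · push_cast at c1 c2 ⊢
      linear_combination c1 - 2 * c2
    · push_cast
      rw [hje, hH, hs]
      field_simp
      ring
  convert key.int_mul (chiThree e) using 1
  ring

/-! ### The harmonic weight -/

theorem sum_alternating_choose_succ {R : Type*} [CommRing R] (n : ℕ) (f : ℕ → R) :
    ∑ j ∈ range (n + 2), (-1 : R) ^ j * (n + 1).choose j * f j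
      = ∑ j ∈ range (n + 1), (-1 : R) ^ j * n.choose j * (f j - f (j + 1)) := by
  have h0 : ∑ j ∈ range (n + 1), (-1 : R) ^ (j + 1) * n.choose (j + 1) * f (j + 1)
      = ∑ j ∈ range n, (-1 : R) ^ (j + 1) * n.choose (j + 1) * f (j + 1) := by
    rw [sum_range_succ]; simp
  have h1 : ∑ j ∈ range (n + 1), (-1 : R) ^ j * n.choose j * f j
      = ∑ j ∈ range n, (-1 : R) ^ (j + 1) * n.choose (j + 1) * f (j + 1) + f 0 := by
    rw [sum_range_succ']; simp
  simp only [mul_sub, sum_sub_distrib]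
  rw [h1, ← h0, sum_range_succ', add_sub_right_comm, ← sum_sub_distrib]
  congr 1
  · refine sum_congr rfl fun j _ => ?_
    rw [Nat.choose_succ_succ]
    push_cast; ring
  · simp

/-- An n-th finite difference kills a polynomial of degree b < n. -/
theorem sum_alternating_choose_mul_choose_eq_zero {R : Type*} [CommRing R] (n x : ℕ) {b : ℕ}
    (hb : b < n) :
    ∑ j ∈ range (n + 1), (-1 : R) ^ j * n.choose j * (x + j).choose b = 0 := by
  induction n generalizing b with
  | zero => omega
  | succ n ih =>
    rw [sum_alternating_choose_succ n (fun j => ((x + j).choose b : R))]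
    rcases b with _ | b
    · simp
    · rw [← neg_eq_zero, ← sum_neg_distrib, ← ih (b := b) (by omega)]
      refine sum_congr rfl fun j _ => ?_
      rw [← add_assoc, Nat.choose_succ_succ]
      push_cast; ring

theorem sum_alternating_choose_div {K : Type*} [Field K] (n x : ℕ)
    (hx : ∀ j ≤ n, (x : K) + 1 + j ≠ 0) :
    ∑ j ∈ range (n + 1), (-1 : K) ^ j * n.choose j * (1 / ((x : K) + 1 + j))
      = n.factorial / (x + 1).ascFactorial (n + 1) := by
  induction n generalizing x with
  | zero => simp [Nat.ascFactorial_succ]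
  | succ n ih =>
    have e : ∑ j ∈ range (n + 2), (-1 : K) ^ j * (n + 1).choose j * (1 / ((x : K) + 1 + j))
        = ∑ j ∈ range (n + 1), (-1 : K) ^ j * n.choose j * (1 / ((x : K) + 1 + j))
          - ∑ j ∈ range (n + 1), (-1 : K) ^ j * n.choose j * (1 / (((x + 1 : ℕ) : K) + 1 + j)) := by
      rw [sum_alternating_choose_succ n (fun j => 1 / ((x : K) + 1 + j)), ← sum_sub_distrib]
      refine sum_congr rfl fun j _ => ?_
      push_cast
      rw [show (x : K) + 1 + (j + 1) = x + 1 + 1 + j by ring]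
      ring
    rw [e, ih x (fun j hj => hx j (by omega)), ih (x + 1) (fun j hj => by
      have := hx (j + 1) (by omega)
      push_cast at this ⊢
      rwa [show (x : K) + 1 + 1 + j = x + 1 + (j + 1) by ring])]
    have a1 : ((x + 1).ascFactorial (n + 1) : K) = (x + 1) * (x + 2).ascFactorial n := by
      have : (x + 1).ascFactorial (n + 1) = (x + 1) * (x + 2).ascFactorial n := by
        rw [Nat.succ_ascFactorial, Nat.ascFactorial_succ]
      rw [this]; push_cast; ring
    have a2 : ((x + 2).ascFactorial (n + 1) : K) = (x + 2 + n) * (x + 2).ascFactorial n := by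
      rw [Nat.ascFactorial_succ]; push_cast; ring
    have a3 : ((x + 1).ascFactorial (n + 2) : K)
        = (x + 1) * ((x + 2 + n) * (x + 2).ascFactorial n) := by
      have : (x + 1).ascFactorial (n + 2) = (x + 1) * (x + 2).ascFactorial (n + 1) := by
        rw [Nat.succ_ascFactorial, Nat.ascFactorial_succ]
      rw [this]; push_cast; rw [a2]
    have n1 : (x : K) + 1 ≠ 0 := by simpa using hx 0 (by omega)
    have n2 : (x : K) + 2 + n ≠ 0 := by
      have := hx (n + 1) le_rfl
      push_cast at this
      rwa [show (x : K) + 2 + n = x + 1 + (n + 1) by ring]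
    have n3 : ((x + 2).ascFactorial n : K) ≠ 0 := by
      rw [Nat.ascFactorial_eq_prod_range]
      push_cast
      refine prod_ne_zero_iff.mpr fun i hi => ?_
      have := hx (i + 1) (by simp only [mem_range] at hi; omega)
      push_cast at this
      rwa [show (x : K) + 2 + i = x + 1 + (i + 1) by ring]
    rw [show x + 1 + 1 = x + 2 by ring, a1, a2, a3, Nat.factorial_succ]
    push_cast
    field_simp
    ring

/-- From (b+1) C(x+j,b+1) = (x+1+j) C(x+j,b) - (b+1) C(x+j,b): the first part cancels the
denominator and sums to zero, so raising b only flips the sign. The case b = 0 is a partial fraction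
expansion. -/
theorem sum_alternating_choose_mul_choose_div {K : Type*} [Field K] (n x : ℕ) {b : ℕ} (hb : b ≤ n)
    (hx : ∀ j ≤ n, (x : K) + 1 + j ≠ 0) (hn : ∀ j < n, (j : K) + 1 ≠ 0) :
    ∑ j ∈ range (n + 1), (-1 : K) ^ j * n.choose j * ((x + j).choose b / ((x : K) + 1 + j))
      = (-1) ^ b * (n.factorial / (x + 1).ascFactorial (n + 1)) := by
  induction b with
  | zero => simpa using sum_alternating_choose_div n x hx
  | succ b ih =>
    have h0 := sum_alternating_choose_mul_choose_eq_zero (R := K) n x (b := b) (by omega)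
    have hb0 := hn b (by omega)
    have e : ∀ j ∈ range (n + 1), (-1 : K) ^ j * n.choose j
          * ((x + j).choose (b + 1) / ((x : K) + 1 + j))
        = 1 / ((b : K) + 1) * ((-1 : K) ^ j * n.choose j * (x + j).choose b)
          - (-1 : K) ^ j * n.choose j * ((x + j).choose b / ((x : K) + 1 + j)) := by
      intro j hj
      have hj' := hx j (by simp only [mem_range] at hj; omega)
      have := succ_mul_cast_choose_succ (R := K) (x + j) b
      push_cast at this
      field_simp
      linear_combination (n.choose j : K) * this
    rw [sum_congr rfl e, sum_sub_distrib, ← mul_sum, h0, ih (by omega), pow_succ]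
    ring

/-- `∑_m F(K,m)/m = 0` and `∑_m F(K,m)/m² = -1/(K² C(2K,K))`, for `F` the Legendre summand and
`K = k + 1`. -/
theorem sum_legendreTerm_div {h : ℕ} (hp : p = 2 * h + 1) {k : ℕ} (hk : k < h) :
    ∑ m ∈ range p, (legendreTerm (k + 1) (m + 1) : ZMod p) / ((m : ZMod p) + 1) = 0 ∧
    ∑ m ∈ range p, (legendreTerm (k + 1) (m + 1) : ZMod p) / ((m : ZMod p) + 1) ^ 2
      = -1 / (((k : ZMod p) + 1) ^ 2 * (2 * (k + 1)).choose (k + 1)) := by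
  have hk0 : (k : ZMod p) + 1 ≠ 0 := cast_succ_ne_zero_of_lt (by omega)
  have hx : ∀ j ≤ k + 1, (k : ZMod p) + 1 + j ≠ 0 := fun j hj => by
    have := cast_ne_zero_of_lt (p := p) (k := k + 1 + j) (by omega) (by omega)
    exact_mod_cast this
  have conv : ∀ f : ZMod p → ZMod p,
      ∑ m ∈ range p, (legendreTerm (k + 1) (m + 1) : ZMod p) * f ((m : ZMod p) + 1)
        = ∑ i ∈ range (k + 1 + 1), (((k + 1 + i).choose (k + 1) * (k + 1).choose i : ZMod p))
          * ((-1) ^ (k + 1 + i) * f ((k : ZMod p) + 1 + i)) := by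
    intro f
    have := sum_range_choose_mul_choose_mul (R := ZMod p) (k := k + 1) (N := p + 1) (by omega)
      (fun m => (-1) ^ m * f m)
    push_cast at this
    rw [← this, sum_range_succ']
    simp only [Nat.choose_zero_succ, Nat.cast_zero, zero_mul, add_zero]
    refine sum_congr rfl fun m _ => ?_
    rw [legendreTerm]
    push_cast
    ring
  have step : ∀ i, ((k + 1 + i).choose (k + 1) : ZMod p)
      = ((k : ZMod p) + 1 + i) * ((k + i).choose k) / (k + 1) := by
    intro i
    have := succ_mul_cast_choose_succ_succ (R := ZMod p) (k + i) k
    rw [show k + 1 + i = k + i + 1 by ring]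
    field_simp
    push_cast at this
    linear_combination this
  constructor
  · have h0 := sum_alternating_choose_mul_choose_eq_zero (R := ZMod p) (k + 1) k (b := k) (by omega)
    simp only [div_eq_mul_inv]
    rw [conv (fun y => y⁻¹)]
    have : ∀ i ∈ range (k + 1 + 1), (((k + 1 + i).choose (k + 1) * (k + 1).choose i : ZMod p))
          * ((-1) ^ (k + 1 + i) * ((k : ZMod p) + 1 + i)⁻¹)
        = (-1) ^ (k + 1) / (k + 1) * ((-1) ^ i * (k + 1).choose i * (k + i).choose k) := by
      intro i hi
      have := hx i (by simp only [mem_range] at hi; omega)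
      rw [step, pow_add]
      field_simp
    rw [sum_congr rfl this, ← mul_sum, h0, mul_zero]
  · have h0 := sum_alternating_choose_mul_choose_div (K := ZMod p) (k + 1) k (b := k) (by omega) hx
      (fun j hj => cast_succ_ne_zero_of_lt (by omega))
    simp only [div_eq_mul_inv]
    rw [conv (fun y => (y ^ 2)⁻¹)]
    have : ∀ i ∈ range (k + 1 + 1), (((k + 1 + i).choose (k + 1) * (k + 1).choose i : ZMod p))
          * ((-1) ^ (k + 1 + i) * (((k : ZMod p) + 1 + i) ^ 2)⁻¹)
        = (-1) ^ (k + 1) / (k + 1) * ((-1) ^ i * (k + 1).choose i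
          * ((k + i).choose k / ((k : ZMod p) + 1 + i))) := by
      intro i hi
      have := hx i (by simp only [mem_range] at hi; omega)
      rw [step, pow_add]
      field_simp
    rw [sum_congr rfl this, ← mul_sum, h0]
    have a1 : ((k + 1).ascFactorial (k + 1 + 1) : ZMod p)
        = (k + 1) * ((k + 1).factorial * (2 * (k + 1)).choose (k + 1)) := by
      have : (k + 1).ascFactorial (k + 1 + 1)
          = (k + 1) * ((k + 1).factorial * (2 * (k + 1)).choose (k + 1)) := by
        rw [Nat.ascFactorial_succ, ← Nat.succ_ascFactorial,
          Nat.ascFactorial_eq_factorial_mul_choose]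
        congr 3; ring
      rw [this]; push_cast; ring
    have hf : ((k + 1).factorial : ZMod p) ≠ 0 := by
      rw [ne_eq, ZMod.natCast_eq_zero_iff, hpf.out.dvd_factorial]; omega
    have hc := centralBinom_cast_ne_zero hp (by omega : k + 1 ≤ h)
    have hs : (-1 : ZMod p) ^ k * (-1) ^ k = 1 := by rw [← mul_pow]; simp
    rw [a1, pow_succ]
    field_simp
    linear_combination -hs

theorem sum_range_sub_mul_eq {R : Type*} [CommRing R] (g H : ℕ → R) (N : ℕ) :
    ∑ m ∈ range N, (g (m + 1) - g m) * H m
      = g N * H N - g 0 * H 0 - ∑ m ∈ range N, g (m + 1) * (H (m + 1) - H m) := by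
  induction N with
  | zero => simp
  | succ N ih => rw [sum_range_succ, ih, sum_range_succ]; ring

/-- Summing the certificate against H_m^{(2)} by parts replaces H by its increment 1/m^2, and the
factor 3(k+1) - 2m leaves the two sums of `sum_legendreTerm_div`. -/
theorem sum_legendreTerm_mul_harmonicSum {h : ℕ} (hp : p = 2 * h + 1) {k : ℕ} (hk : k ≤ h) :
    ∑ m ∈ range p, (legendreTerm k m : ZMod p) * harmonicSum (ZMod p) 2 m
      = 3 * ∑ i ∈ Ico 1 (k + 1), 1 / ((i : ZMod p) ^ 2 * (2 * i).choose i) := by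
  induction k with
  | zero =>
    rw [sum_eq_single_of_mem 0 (by simp [hpf.out.pos])]
    · simp [harmonicSum]
    · intro m _ hm
      rw [legendreTerm_of_two_mul_lt (by omega)]; simp
  | succ k ih =>
    have hk0 : (k : ZMod p) + 1 ≠ 0 := cast_succ_ne_zero_of_lt (by omega)
    have hc := centralBinom_cast_ne_zero hp hk
    rw [sum_Ico_succ_top (by omega), mul_add, ← ih (by omega), ← sub_eq_iff_eq_add',
      ← sum_sub_distrib]
    apply mul_left_cancel₀ hk0
    set g : ℕ → ZMod p := fun m => (legendreTerm (k + 1) m : ZMod p) * (3 * (k + 1) - 2 * m) with hg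
    have e1 : ((k : ZMod p) + 1) * ∑ m ∈ range p,
          ((legendreTerm (k + 1) m : ZMod p) * harmonicSum (ZMod p) 2 m
            - (legendreTerm k m : ZMod p) * harmonicSum (ZMod p) 2 m)
        = ∑ m ∈ range p, (g (m + 1) - g m) * harmonicSum (ZMod p) 2 m := by
      rw [mul_sum]
      refine sum_congr rfl fun m _ => ?_
      have := congrArg (Int.cast : ℤ → ZMod p) (legendreTerm_certificate k m)
      simp only [hg]
      push_cast at this ⊢
      linear_combination harmonicSum (ZMod p) 2 m * this
    obtain ⟨s1, s2⟩ := sum_legendreTerm_div hp (show k < h by omega)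
    have e2 : ∑ m ∈ range p, g (m + 1) * (harmonicSum (ZMod p) 2 (m + 1) - harmonicSum (ZMod p) 2 m)
        = 3 * (k + 1) * ∑ m ∈ range p, (legendreTerm (k + 1) (m + 1) : ZMod p) / ((m : ZMod p) + 1) ^ 2
          - 2 * ∑ m ∈ range p, (legendreTerm (k + 1) (m + 1) : ZMod p) / ((m : ZMod p) + 1) := by
      rw [mul_sum, mul_sum, ← sum_sub_distrib]
      refine sum_congr rfl fun m _ => ?_
      rw [harmonicSum_succ, add_sub_cancel_left]
      simp only [hg]
      push_cast
      -- At m = p-1 the denominator vanishes in `ZMod p`; both sides are then 0 since division by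
      -- zero is 0.
      by_cases hm : (m : ZMod p) + 1 = 0
      · simp [hm]
      · field_simp
    rw [e1, sum_range_sub_mul_eq, e2, s1, s2]
    have g1 : g p = 0 := by simp [hg, legendreTerm_of_two_mul_lt (show 2 * (k + 1) < p by omega)]
    have g0 : g 0 = 0 := by simp [hg, legendreTerm_of_lt (Nat.succ_pos k)]
    rw [g1, g0]
    push_cast
    field_simp
    ring

theorem sum_alternating_aperyNumber_congrPow {h : ℕ} (hp : p = 2 * h + 1) :
    ∃ S : ℤ, ∑ k ∈ range p, (-1 : ℤ) ^ k * (2 * k + 1) * aperyNumber k = p * S ∧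
      CongrPow p 2 (S - chiThree p)
        (2 * ∑ e ∈ Ico 1 p, (chiThree e : ZMod p) * (-1) ^ e * harmonicSum (ZMod p) 1 e / e
          - 3 * ∑ l ∈ Ico 1 (h + 1), 1 / (l * (2 * l).choose l : ZMod p)
            * ∑ i ∈ Ico l (h + 1), ((2 * i).choose i : ZMod p) / i
          - 3 * ∑ k ∈ range (h + 1), ((2 * k).choose k : ZMod p)
            * ∑ i ∈ Ico 1 (k + 1), 1 / ((i : ZMod p) ^ 2 * (2 * i).choose i)) := by
  have hn : 2 * h + 1 = p := hp.symm
  have hA := sum_alternating_aperyNumber (2 * h)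
  rw [hn] at hA
  refine ⟨∑ k ∈ range p, ((2 * k).choose k : ℤ)
    * ∑ m ∈ range p, (m.choose k * k.choose (m - k) : ℤ)
      * ((2 * h).choose m * (p + m).choose m), ?_, ?_⟩
  · rw [hA, (even_two_mul h).neg_one_pow]
    have : (p : ℤ) = 2 * h + 1 := by exact_mod_cast hp
    rw [this]; push_cast; ring
  · have c1 := sum_centralBinom_congrPow hp
    have c2 := sum_centralBinom_mul_sub hp
    have c3 : CongrPow p 2 (∑ k ∈ range p, ((2 * k).choose k : ℤ)
          * ∑ m ∈ range p, legendreTerm k m * ((-1) ^ m * ((2 * h).choose m * (p + m).choose m) - 1))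
        (∑ k ∈ range p, (((2 * k).choose k : ℤ) : ZMod p)
          * ∑ m ∈ range p, (legendreTerm k m : ZMod p) * (-harmonicSum (ZMod p) 2 m)) := by
      refine CongrPow.sum fun k _ => CongrPow.int_mul _ (CongrPow.sum fun m hm => ?_)
      have := congrPow_alternating_choose_mul_choose hn (mem_range.mp hm)
      rw [hn] at this
      exact this.int_mul _
    have e3 : ∑ k ∈ range p, (((2 * k).choose k : ℤ) : ZMod p)
          * ∑ m ∈ range p, (legendreTerm k m : ZMod p) * (-harmonicSum (ZMod p) 2 m)
        = -3 * ∑ k ∈ range (h + 1), ((2 * k).choose k : ZMod p)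
            * ∑ i ∈ Ico 1 (k + 1), 1 / ((i : ZMod p) ^ 2 * (2 * i).choose i) := by
      have hsub : range (h + 1) ⊆ range p := by
        intro x hx; simp only [mem_range] at *; omega
      rw [← sum_subset hsub, mul_sum]
      · refine sum_congr rfl fun k hk => ?_
        simp only [mul_neg, sum_neg_distrib]
        rw [sum_legendreTerm_mul_harmonicSum hp (by simp only [mem_range] at hk; omega)]
        push_cast; ring
      · intro k hk hk'
        simp only [mem_range, not_lt] at hk hk'
        have := centralBinom_cast_eq_zero hp (show h < k by omega) hk
        simp [this]
    rw [e3] at c3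
    convert (c1.add c2).add c3 using 1
    · rw [sub_add_eq_add_sub, sub_add_eq_add_sub, ← sum_add_distrib, ← sum_add_distrib]
      congr 1
      refine sum_congr rfl fun k _ => ?_
      rw [mul_sub, mul_one, add_sub_cancel, ← mul_add, ← sum_add_distrib]
      congr 1
      refine sum_congr rfl fun m _ => ?_
      have : (-1 : ℤ) ^ m * (-1) ^ m = 1 := by rw [← mul_pow]; simp
      rw [legendreTerm]
      linear_combination -((m.choose k * k.choose (m - k) : ℤ)
        * ((2 * h).choose m * (p + m).choose m)) * this
    · ring

end LegendreSums

/-! ### Double sums with binomial tails, over a general field. -/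

section BinomialExpansions

theorem sum_range_choose_add_mul_pow {R : Type*} [CommRing R] (x : R) (n i N : ℕ) (hN : n ≤ N + i) :
    ∑ j ∈ range N, (n.choose (i + 1 + j) : R) * x ^ j
      = ∑ b ∈ range n, (b.choose i : R) * (1 + x) ^ (n - 1 - b) := by
  induction n generalizing N with
  | zero =>
    rw [range_zero, sum_empty]
    exact sum_eq_zero fun j _ => by rw [Nat.choose_eq_zero_of_lt (by omega)]; simp
  | succ n ih =>
    have h1 : ∑ b ∈ range n, (b.choose i : R) * (1 + x) ^ (n + 1 - 1 - b)
        = (1 + x) * ∑ b ∈ range n, (b.choose i : R) * (1 + x) ^ (n - 1 - b) := by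
      rw [mul_sum]
      refine sum_congr rfl fun b hb => ?_
      rw [show n + 1 - 1 - b = n - 1 - b + 1 by simp only [mem_range] at hb; omega, pow_succ]
      ring
    rw [sum_range_succ, h1, Nat.add_sub_cancel, Nat.sub_self, pow_zero, mul_one, add_mul, one_mul]
    rcases N with _ | N
    · have hni : n < i := by omega
      have hz : ∑ b ∈ range n, (b.choose i : R) * (1 + x) ^ (n - 1 - b) = 0 :=
        sum_eq_zero fun b hb => by
          rw [Nat.choose_eq_zero_of_lt (by simp only [mem_range] at hb; omega)]; simp
      rw [hz, Nat.choose_eq_zero_of_lt hni]; simp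
    · have hA := ih (N + 1) (by omega)
      have hB := ih N (by omega)
      have e : ∀ j, ((n + 1).choose (i + 1 + j) : R) = n.choose (i + 1 + j) + n.choose (i + j) := by
        intro j
        rw [show i + 1 + j = i + j + 1 by ring, Nat.choose_succ_succ]; push_cast; ring
      simp_rw [e, add_mul]
      rw [sum_add_distrib, hA, sum_range_succ', add_assoc, pow_zero, mul_one, add_zero, ← hB, mul_sum]
      congr 2
      refine sum_congr rfl fun j _ => ?_
      rw [show i + 1 + j = i + (j + 1) by ring, pow_succ]; ring

/-- Sort the subsets with more than i elements by the position b of their element number i+1: C(b,i)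
choices before it, and weight 1+x for each place after it. -/
theorem sum_Ico_choose_mul_pow {R : Type*} [CommRing R] (x : R) (n i : ℕ) :
    ∑ k ∈ Ico (i + 1) (n + 1), (n.choose k : R) * x ^ k
      = x ^ (i + 1) * ∑ b ∈ range n, (b.choose i : R) * (1 + x) ^ (n - 1 - b) := by
  rw [sum_Ico_eq_sum_range, show n + 1 - (i + 1) = n - i by omega,
    ← sum_range_choose_add_mul_pow x n i (n - i) (by omega), mul_sum]
  exact sum_congr rfl fun j _ => by rw [pow_add]; ring

variable {K : Type*} [Field K]

theorem sum_Ico_choose_mul_pow_div {n : ℕ} (hn : ∀ k < n, (k : K) + 1 ≠ 0) (x : K) (i : ℕ) :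
    ∑ k ∈ Ico (i + 1) (n + 1), (n.choose k : K) * x ^ k / k
      = ∑ m ∈ range n, 1 / ((m : K) + 1)
          * ∑ k ∈ Ico (i + 1) (m + 1 + 1), ((m + 1).choose k : K) * x ^ k := by
  induction n with
  | zero => simp
  | succ n ih =>
    rw [sum_range_succ, ← ih fun k hk => hn k (by omega), mul_sum]
    have e0 : ∑ k ∈ Ico (i + 1) (n + 1), (n.choose k : K) * x ^ k / k
        = ∑ k ∈ Ico (i + 1) (n + 1 + 1), (n.choose k : K) * x ^ k / k := by
      rcases le_or_gt (i + 1) (n + 1) with h | h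
      · rw [sum_Ico_succ_top h]; simp
      · rw [Ico_eq_empty (by omega), Ico_eq_empty (by omega)]
    rw [e0, ← sum_add_distrib]
    refine sum_congr rfl fun k hk => ?_
    simp only [mem_Ico] at hk
    obtain ⟨j, rfl⟩ : ∃ j, k = j + 1 := ⟨k - 1, by omega⟩
    have hj := hn j (by omega)
    have hn' := hn n (by omega)
    have h1 := succ_mul_cast_choose_succ_succ (R := K) n j
    have h2 : ((n + 1).choose (j + 1) : K) = n.choose j + n.choose (j + 1) := by
      rw [Nat.choose_succ_succ]; push_cast; rfl
    push_cast
    field_simp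
    rw [h2] at h1 ⊢
    linear_combination -x ^ (j + 1) * h1

/-- Up to the factor 1/(n-b), the summand is the decrement in j of C(b,j)/C(n,j). -/
theorem sum_choose_div_choose {n : ℕ} (hn : ∀ k < n, (k : K) + 1 ≠ 0)
    (hc : ∀ k ≤ n, (n.choose k : K) ≠ 0) {b : ℕ} (hb : b < n) :
    ∑ j ∈ range n, (b.choose j : K) / ((j + 1) * n.choose (j + 1)) = 1 / ((n : K) - b) := by
  have hsub : ∀ j < n, (n : K) - j ≠ 0 := fun j hj => by
    have := hn (n - j - 1) (by omega)
    rwa [← Nat.cast_succ, show (n - j - 1).succ = n - j by omega, Nat.cast_sub hj.le] at this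
  have key : ∀ j ∈ range n, (b.choose j : K) / ((j + 1) * n.choose (j + 1))
      = 1 / ((n : K) - b) * ((b.choose j : K) / n.choose j
        - (b.choose (j + 1) : K) / n.choose (j + 1)) := by
    intro j hj
    simp only [mem_range] at hj
    have a1 := hn j hj
    have a2 := hc j hj.le
    have a3 := hc (j + 1) hj
    have a4 := hsub j hj
    have a5 := hsub b hb
    have h1 := succ_mul_cast_choose_succ (R := K) n j
    have h2 := succ_mul_cast_choose_succ (R := K) b j
    have g1 : (n.choose (j + 1) : K) = (n - j) * n.choose j / (j + 1) := by
      field_simp; linear_combination h1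
    have g2 : (b.choose (j + 1) : K) = (b - j) * b.choose j / (j + 1) := by
      field_simp; linear_combination h2
    rw [g1, g2]
    field_simp
    ring
  rw [sum_congr rfl key, ← mul_sum,
    sum_range_sub' (fun j => (b.choose j : K) / n.choose j), Nat.choose_eq_zero_of_lt hb]
  simp

theorem sum_choose_succ_div_choose {n : ℕ} (hn : ∀ k < n, (k : K) + 1 ≠ 0)
    (hc : ∀ k ≤ n, (n.choose k : K) ≠ 0) {N : ℕ} (hN : N ≤ n) :
    ∑ j ∈ range n, (N.choose (j + 1) : K) / ((j + 1) * n.choose (j + 1))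
      = ∑ j ∈ range N, 1 / ((n : K) - j) := by
  induction N with
  | zero => simp
  | succ N ih =>
    rw [sum_range_succ, ← ih (by omega), ← sum_choose_div_choose hn hc hN, ← sum_add_distrib]
    refine sum_congr rfl fun j _ => ?_
    rw [Nat.choose_succ_succ]; push_cast; ring

/-- Expanding the tail in powers of 1+x cancels x^i, and the sum over i is then one of the
reciprocal sums just evaluated. -/
theorem sum_inv_sq_choose_mul_tail {n : ℕ} (hn : ∀ k < n, (k : K) + 1 ≠ 0)
    (hc : ∀ k ≤ n, (n.choose k : K) ≠ 0) {x : K} (hx : x ≠ 0) :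
    ∑ i ∈ Ico 1 (n + 1), 1 / ((i : K) ^ 2 * (n.choose i * x ^ i))
        * ∑ k ∈ Ico i (n + 1), (n.choose k : K) * x ^ k
      = ∑ b ∈ range n, (1 + x) ^ (n - 1 - b) / ((b : K) + 1)
          * ∑ j ∈ range (b + 1), 1 / ((n : K) - j) := by
  rw [sum_Ico_eq_sum_range, Nat.add_sub_cancel]
  have e1 : ∀ i ∈ range n, 1 / (((1 + i : ℕ) : K) ^ 2 * (n.choose (1 + i) * x ^ (1 + i)))
        * ∑ k ∈ Ico (1 + i) (n + 1), (n.choose k : K) * x ^ k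
      = ∑ b ∈ range n, (1 + x) ^ (n - 1 - b) / ((b : K) + 1)
          * (((b + 1).choose (i + 1) : K) / ((i + 1) * n.choose (i + 1))) := by
    intro i hi
    simp only [mem_range] at hi
    rw [add_comm 1 i, sum_Ico_choose_mul_pow, mul_sum, mul_sum]
    refine sum_congr rfl fun b hb => ?_
    simp only [mem_range] at hb
    have a1 := hn i hi
    have a2 := hc (i + 1) hi
    have a3 := hn b hb
    have h1 := succ_mul_cast_choose_succ_succ (R := K) b i
    push_cast
    field_simp
    linear_combination -(1 + x) ^ (n - 1 - b) * h1
  rw [sum_congr rfl e1, sum_comm]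
  refine sum_congr rfl fun b hb => ?_
  rw [← mul_sum, sum_choose_succ_div_choose hn hc (by simpa using hb)]

theorem sum_inv_choose_mul_tail_div {n : ℕ} (hn : ∀ k < n, (k : K) + 1 ≠ 0)
    (hc : ∀ k ≤ n, (n.choose k : K) ≠ 0) {x : K} (hx : x ≠ 0) :
    ∑ i ∈ Ico 1 (n + 1), 1 / ((i : K) * (n.choose i * x ^ i))
        * ∑ k ∈ Ico i (n + 1), (n.choose k : K) * x ^ k / k
      = ∑ b ∈ range n, (1 + x) ^ (n - 1 - b)
          * ∑ j ∈ range (b + 1), 1 / (((n : K) - (b - j : ℕ)) * ((n : K) - j)) := by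
  rw [sum_Ico_eq_sum_range, Nat.add_sub_cancel]
  have e1 : ∀ i ∈ range n, 1 / (((1 + i : ℕ) : K) * (n.choose (1 + i) * x ^ (1 + i)))
        * ∑ k ∈ Ico (1 + i) (n + 1), (n.choose k : K) * x ^ k / k
      = ∑ m ∈ range n, ∑ b ∈ range (m + 1), (1 + x) ^ (m - b) / ((m : K) + 1)
          * ((b.choose i : K) / ((i + 1) * n.choose (i + 1))) := by
    intro i hi
    simp only [mem_range] at hi
    rw [add_comm 1 i, sum_Ico_choose_mul_pow_div hn, mul_sum]
    refine sum_congr rfl fun m hm => ?_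
    rw [sum_Ico_choose_mul_pow, mul_sum, mul_sum, mul_sum]
    refine sum_congr rfl fun b hb => ?_
    simp only [mem_range] at hb hm
    have a1 := hn i hi
    have a2 := hc (i + 1) hi
    have a3 := hn m hm
    push_cast
    field_simp
  have e2 : ∀ m ∈ range n, ∑ b ∈ range (m + 1), ∑ i ∈ range n, (1 + x) ^ (m - b) / ((m : K) + 1)
          * ((b.choose i : K) / ((i + 1) * n.choose (i + 1)))
      = ∑ a ∈ range (m + 1), (1 + x) ^ a / ((a + (m - a : ℕ) : K) + 1)
          * (1 / ((n : K) - (m - a : ℕ))) := by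
    intro m hm
    simp only [mem_range] at hm
    rw [← sum_flip]
    refine sum_congr rfl fun a ha => ?_
    simp only [mem_range] at ha
    rw [← mul_sum, sum_choose_div_choose hn hc (by omega), Nat.sub_sub_self (by omega),
      ← Nat.cast_add, Nat.add_sub_cancel' (by omega)]
  rw [sum_congr rfl e1, sum_comm]
  simp_rw [sum_comm (s := range n) (t := range _)]
  rw [sum_congr rfl e2, sum_range_diag_flip n (fun a b => (1 + x) ^ a / (((a : K) + b) + 1)
          * (1 / ((n : K) - b))), ← sum_range_reflect]
  refine sum_congr rfl fun b hb => ?_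
  simp only [mem_range] at hb
  rw [show n - (n - 1 - b) = b + 1 by omega, mul_sum]
  refine sum_congr rfl fun j hj => ?_
  simp only [mem_range] at hj
  rw [Nat.cast_sub (show j ≤ b by omega), Nat.cast_sub (show b ≤ n - 1 by omega),
    Nat.cast_sub (show 1 ≤ n by omega)]
  rw [div_mul_div_comm, mul_one, mul_one_div]
  congr 2
  push_cast
  ring

end BinomialExpansions

/-! ### Specialization to n = (p-1)/2 and x = -4. -/

section HalfPrime

variable {p : ℕ} [hpf : Fact p.Prime]

theorem centralBinom_cast_eq {h : ℕ} (hp : p = 2 * h + 1) {k : ℕ} (hk : k < p) :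
    ((2 * k).choose k : ZMod p) = h.choose k * (-4) ^ k := by
  induction k with
  | zero => simp
  | succ k ih =>
    apply mul_left_cancel₀ (cast_succ_ne_zero_of_lt hk)
    have h1 := succ_mul_cast_centralBinom (R := ZMod p) k
    have h2 := succ_mul_cast_choose_succ (R := ZMod p) h k
    have h3 : 2 * (h : ZMod p) + 1 = 0 := by
      have : ((2 * h + 1 : ℕ) : ZMod p) = 0 := by rw [← hp]; simp
      exact_mod_cast this
    rw [h1, ih (by omega), pow_succ]
    linear_combination 4 * (-4) ^ k * h2 + 2 * (h.choose k : ZMod p) * (-4) ^ k * h3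

/-- The two double sums over central binomial coefficients, as one power sum in `-3`. -/
theorem sum_centralBinom_mul_sum_inv {h : ℕ} (hp : p = 2 * h + 1) :
    ∑ k ∈ range (h + 1), ((2 * k).choose k : ZMod p)
        * ∑ i ∈ Ico 1 (k + 1), 1 / ((i : ZMod p) ^ 2 * (2 * i).choose i)
      = ∑ b ∈ range h, (-3 : ZMod p) ^ (h - 1 - b) / ((b : ZMod p) + 1)
          * ∑ j ∈ range (b + 1), 1 / ((h : ZMod p) - j) ∧
    ∑ l ∈ Ico 1 (h + 1), 1 / (l * (2 * l).choose l : ZMod p)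
        * ∑ i ∈ Ico l (h + 1), ((2 * i).choose i : ZMod p) / i
      = -2 * ∑ b ∈ range h, (-3 : ZMod p) ^ (h - 1 - b) / ((b : ZMod p) + 1)
          * ∑ j ∈ range (b + 1), 1 / ((h : ZMod p) - j) := by
  have hn : ∀ k < h, (k : ZMod p) + 1 ≠ 0 := fun k hk => cast_succ_ne_zero_of_lt (by omega)
  have hc : ∀ k ≤ h, (h.choose k : ZMod p) ≠ 0 := by
    intro k hk h0
    apply centralBinom_cast_ne_zero hp hk
    rw [centralBinom_cast_eq hp (by omega), h0, zero_mul]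
  have h2 := two_ne_zero_of_odd hp
  have hx : (-4 : ZMod p) ≠ 0 := by
    have : (-4 : ZMod p) = -(2 * 2) := by norm_num
    rw [this]; exact neg_ne_zero.mpr (mul_ne_zero h2 h2)
  have h3 : 2 * (h : ZMod p) + 1 = 0 := by
    have : ((2 * h + 1 : ℕ) : ZMod p) = 0 := by rw [← hp]; simp
    exact_mod_cast this
  have hy : (1 : ZMod p) + -4 = -3 := by norm_num
  constructor
  · have := sum_inv_sq_choose_mul_tail hn hc hx
    rw [hy] at this
    rw [← this, range_eq_Ico, sum_eq_sum_Ico_succ_bot (by omega)]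
    simp only [mul_sum]
    rw [sum_Ico_Ico_comm]
    simp only [zero_add, Ico_self, sum_empty]
    refine sum_congr rfl fun k hk => sum_congr rfl fun i hi => ?_
    simp only [mem_Ico] at hk hi
    rw [centralBinom_cast_eq hp (by omega), centralBinom_cast_eq hp (by omega)]
    ring
  · have := sum_inv_choose_mul_tail_div hn hc hx
    rw [hy] at this
    have e : ∑ l ∈ Ico 1 (h + 1), 1 / (l * (2 * l).choose l : ZMod p)
          * ∑ i ∈ Ico l (h + 1), ((2 * i).choose i : ZMod p) / i
        = ∑ i ∈ Ico 1 (h + 1), 1 / ((i : ZMod p) * (h.choose i * (-4) ^ i))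
          * ∑ k ∈ Ico i (h + 1), (h.choose k : ZMod p) * (-4) ^ k / k := by
      refine sum_congr rfl fun l hl => ?_
      simp only [mem_Ico] at hl
      rw [centralBinom_cast_eq hp (by omega)]
      congr 1
      refine sum_congr rfl fun k hk => ?_
      simp only [mem_Ico] at hk
      rw [centralBinom_cast_eq hp (by omega)]
    rw [e, this, mul_sum]
    refine sum_congr rfl fun b hb => ?_
    simp only [mem_range] at hb
    have hb0 := hn b hb
    have hsub : ∀ j ≤ b, (h : ZMod p) - j ≠ 0 := fun j hj => by
      have := hn (h - j - 1) (by omega)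
      rwa [← Nat.cast_succ, show (h - j - 1).succ = h - j by omega,
        Nat.cast_sub (by omega)] at this
    -- The two factors add up to 2h - b = -(b+1) modulo p. Partial fractions thus give two equal
    -- halves after j ↦ b-j, which is the source of the factor -2.
    have s : ∑ j ∈ range (b + 1), 1 / (((h : ZMod p) - (b - j : ℕ)) * ((h : ZMod p) - j))
        = ∑ j ∈ range (b + 1), (-1 / ((b : ZMod p) + 1)) * (1 / ((h : ZMod p) - (b - j : ℕ)))
          + ∑ j ∈ range (b + 1), (-1 / ((b : ZMod p) + 1)) * (1 / ((h : ZMod p) - j)) := by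
      rw [← sum_add_distrib]
      refine sum_congr rfl fun j hj => ?_
      simp only [mem_range] at hj
      have a1 := hsub j (by omega)
      have a2 := hsub (b - j) (by omega)
      rw [Nat.cast_sub (by omega)] at a2 ⊢
      field_simp
      linear_combination h3
    rw [s, ← mul_sum, ← mul_sum, sum_flip (fun j => 1 / ((h : ZMod p) - (j : ℕ)))]
    field_simp
    ring

end HalfPrime

/-! ### Functional equations of the finite dilogarithm in characteristic p. -/

section FiniteDilogarithm

/-- The truncated dilogarithm `∑_{i=1}^n w^i / i²`. -/
def finiteDilog {K : Type*} [Field K] (n : ℕ) (w : K) : K :=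
  ∑ i ∈ range n, w ^ (i + 1) / ((i : K) + 1) ^ 2

variable {K : Type*} [Field K]

theorem sum_one_sub_pow_div {N : ℕ} (hN : ∀ k < N, (k : K) + 1 ≠ 0) (v : K) :
    ∑ j ∈ range N, (1 - (1 - v) ^ (j + 1)) / ((j : K) + 1)
      = ∑ k ∈ range N, -(-v) ^ (k + 1) * N.choose (k + 1) / ((k : K) + 1) := by
  induction N with
  | zero => simp
  | succ N ih =>
    rw [sum_range_succ, ih fun k hk => hN k (by omega)]
    have e0 : ∑ k ∈ range N, -(-v) ^ (k + 1) * N.choose (k + 1) / ((k : K) + 1)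
        = ∑ k ∈ range (N + 1), -(-v) ^ (k + 1) * N.choose (k + 1) / ((k : K) + 1) := by
      rw [sum_range_succ]; simp
    have e1 : (1 - (1 - v) ^ (N + 1)) / ((N : K) + 1)
        = ∑ k ∈ range (N + 1), -(-v) ^ (k + 1) * (N + 1).choose (k + 1) / ((N : K) + 1) := by
      rw [← sum_div]
      congr 1
      rw [show (1 - v) = -v + 1 by ring, add_pow, sum_range_succ']
      simp [sum_neg_distrib]
    rw [e0, e1, ← sum_add_distrib]
    refine sum_congr rfl fun k hk => ?_
    have a1 := hN k (by simpa using hk)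
    have a2 := hN N (by omega)
    have h1 := succ_mul_cast_choose_succ_succ (R := K) N k
    have h2 : ((N + 1).choose (k + 1) : K) = N.choose k + N.choose (k + 1) := by
      rw [Nat.choose_succ_succ]; push_cast; rfl
    rw [h2] at h1 ⊢
    field_simp
    linear_combination -(-v) ^ (k + 1) * h1

theorem sum_sum_one_sub_pow_div {N : ℕ} (hN : ∀ k < N, (k : K) + 1 ≠ 0) (v : K) :
    ∑ m ∈ range N, 1 / ((m : K) + 1)
        * ∑ j ∈ range (m + 1), (1 - (1 - v) ^ (j + 1)) / ((j : K) + 1)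
      = ∑ k ∈ range N, -(-v) ^ (k + 1) * N.choose (k + 1) / ((k : K) + 1) ^ 2 := by
  induction N with
  | zero => simp
  | succ N ih =>
    rw [sum_range_succ, ih fun k hk => hN k (by omega), sum_one_sub_pow_div hN]
    have e0 : ∑ k ∈ range N, -(-v) ^ (k + 1) * N.choose (k + 1) / ((k : K) + 1) ^ 2
        = ∑ k ∈ range (N + 1), -(-v) ^ (k + 1) * N.choose (k + 1) / ((k : K) + 1) ^ 2 := by
      rw [sum_range_succ]; simp
    rw [e0, mul_sum, ← sum_add_distrib]
    refine sum_congr rfl fun k hk => ?_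
    have a1 := hN k (by simpa using hk)
    have a2 := hN N (by omega)
    have h1 := succ_mul_cast_choose_succ_succ (R := K) N k
    have h2 : ((N + 1).choose (k + 1) : K) = N.choose k + N.choose (k + 1) := by
      rw [Nat.choose_succ_succ]; push_cast; rfl
    rw [h2] at h1 ⊢
    field_simp
    linear_combination -(-v) ^ (k + 1) * h1

theorem sum_range_two_mul {R : Type*} [AddCommMonoid R] (f : ℕ → R) (n : ℕ) :
    ∑ i ∈ range (2 * n), f i = ∑ j ∈ range n, f (2 * j) + ∑ j ∈ range n, f (2 * j + 1) := by
  induction n with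
  | zero => simp
  | succ n ih =>
    rw [show 2 * (n + 1) = 2 * n + 1 + 1 by ring, sum_range_succ, sum_range_succ, ih,
      sum_range_succ, sum_range_succ]
    abel

variable {p h : ℕ} [CharP K p]


theorem charP_cast_ne_zero (K : Type*) [Field K] {p : ℕ} [CharP K p] {k : ℕ} (h0 : 0 < k)
    (hk : k < p) : (k : K) ≠ 0 := by
  rw [ne_eq, CharP.cast_eq_zero_iff K p]
  exact Nat.not_dvd_of_pos_of_lt h0 hk

theorem charP_cast_succ_ne_zero (K : Type*) [Field K] {p : ℕ} [CharP K p] {k : ℕ}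
    (hk : k + 1 < p) : (k : K) + 1 ≠ 0 := by
  exact_mod_cast charP_cast_ne_zero K (Nat.succ_pos k) hk

theorem charP_two_mul_add_one (K : Type*) [Field K] {p h : ℕ} [CharP K p] (hp : p = 2 * h + 1) :
    2 * (h : K) + 1 = 0 := by
  have : ((2 * h + 1 : ℕ) : K) = 0 := by rw [← hp]; exact CharP.cast_eq_zero K p
  exact_mod_cast this

theorem cast_choose_two_mul (hp : p = 2 * h + 1) {k : ℕ} (hk : k < p) :
    ((2 * h).choose k : K) = (-1) ^ k := by
  induction k with
  | zero => simp
  | succ k ih =>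
    have h1 := succ_mul_cast_choose_succ (R := K) (2 * h) k
    have h3 := charP_two_mul_add_one K hp
    apply mul_left_cancel₀ (charP_cast_succ_ne_zero K hk)
    rw [h1, ih (by omega), pow_succ]
    push_cast
    linear_combination (-1) ^ k * h3

/-- Inversion, by the substitution i ↦ p-i. -/
theorem finiteDilog_inv (hp : p = 2 * h + 1) {w : K} (hw : w ≠ 0) :
    w ^ p * finiteDilog (2 * h) w⁻¹ = finiteDilog (2 * h) w := by
  have h3 := charP_two_mul_add_one K hp
  rw [finiteDilog, finiteDilog, ← sum_range_reflect, mul_sum]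
  refine sum_congr rfl fun i hi => ?_
  simp only [mem_range] at hi
  have a1 := charP_cast_succ_ne_zero K (show i + 1 < p by omega)
  have a2 : ((2 * h - 1 - i : ℕ) : K) + 1 = -(i + 1) := by
    rw [show 2 * h - 1 - i = 2 * h - (i + 1) by omega, Nat.cast_sub (by omega)]
    push_cast
    linear_combination h3
  rw [a2, show p = 2 * h - 1 - i + 1 + (i + 1) by omega, pow_add]
  field_simp
  rw [← mul_pow, mul_one_div_cancel hw, one_pow]

/-- Duplication: w^{2i}/i^2 = 4 w^{2i}/(2i)^2. For i ≤ h the index 2i is an even number below p; for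
i > h it is p plus an odd number, which pulls out w^p. -/
theorem finiteDilog_sq (hp : p = 2 * h + 1) (w : K) :
    finiteDilog (2 * h) (w ^ 2)
      = 2 * ((1 + w ^ p) * finiteDilog (2 * h) w + (1 - w ^ p) * finiteDilog (2 * h) (-w)) := by
  have h3 := charP_two_mul_add_one K hp
  have hodd : Odd p := ⟨h, hp⟩
  have l : finiteDilog (2 * h) (w ^ 2)
      = ∑ j ∈ range h, 4 * w ^ (2 * j + 2) / ((2 * j + 1 : ℕ) + 1 : K) ^ 2
        + ∑ j ∈ range h, 4 * w ^ (p + (2 * j + 1)) / ((2 * j : ℕ) + 1 : K) ^ 2 := by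
    rw [finiteDilog, two_mul h, sum_range_add]
    congr 1
    · refine sum_congr rfl fun j hj => ?_
      simp only [mem_range] at hj
      have h2 : (2 : K) ≠ 0 := by
        exact_mod_cast charP_cast_ne_zero K (p := p) (show 0 < 2 by norm_num) (by omega)
      have a1 := charP_cast_succ_ne_zero K (show j + 1 < p by omega)
      have e : (((2 * j + 1 : ℕ) : K) + 1) = 2 * (j + 1) := by push_cast; ring
      rw [e]
      field_simp
      ring
    · refine sum_congr rfl fun j hj => ?_
      simp only [mem_range] at hj
      have a1 := charP_cast_succ_ne_zero K (show h + j + 1 < p by omega)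
      have e : (((2 * j : ℕ) : K) + 1) = 2 * ((h + j : ℕ) + 1) := by
        push_cast; linear_combination -h3
      have h2 : (2 : K) ≠ 0 := by
        exact_mod_cast charP_cast_ne_zero K (p := p) (show 0 < 2 by norm_num) (by omega)
      rw [e, show p + (2 * j + 1) = 2 * (h + j + 1) by omega, pow_mul]
      field_simp
      ring
  have r : ∀ u : K, finiteDilog (2 * h) u
      = ∑ j ∈ range h, u ^ (2 * j + 1) / ((2 * j : ℕ) + 1 : K) ^ 2
        + ∑ j ∈ range h, u ^ (2 * j + 2) / ((2 * j + 1 : ℕ) + 1 : K) ^ 2 := by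
    intro u
    rw [finiteDilog, sum_range_two_mul]
  rw [l, r w, r (-w)]
  have o : ∀ j, (-w) ^ (2 * j + 1) = -w ^ (2 * j + 1) := fun j => Odd.neg_pow ⟨j, rfl⟩ w
  have e : ∀ j, (-w) ^ (2 * j + 2) = w ^ (2 * j + 2) := fun j => Even.neg_pow ⟨j + 1, by ring⟩ w
  simp only [o, e, pow_add w p, neg_div, sum_neg_distrib, mul_div_assoc, ← mul_sum]
  ring

theorem finiteDilog_one (hp : p = 2 * h + 1) (hp3 : 3 < p) : finiteDilog (2 * h) (1 : K) = 0 := by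
  have h1 := finiteDilog_sq hp (1 : K)
  have h3 : (3 : K) ≠ 0 := by exact_mod_cast charP_cast_ne_zero K (p := p) (by norm_num) hp3
  simp only [one_pow, sub_self, zero_mul, add_zero] at h1
  have : 3 * finiteDilog (2 * h) (1 : K) = 0 := by linear_combination -h1
  exact (mul_eq_zero.mp this).resolve_left h3

variable [hpf : Fact p.Prime]

theorem finiteDilog_neg_one (hp : p = 2 * h + 1) : finiteDilog (2 * h) (-1 : K) = 0 := by
  have h1 := finiteDilog_inv hp (neg_ne_zero.mpr (one_ne_zero (α := K)))
  rw [inv_neg, inv_one, Odd.neg_one_pow ⟨h, hp⟩] at h1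
  have h2 : (2 : K) ≠ 0 := by
    have := hpf.out.two_le
    exact_mod_cast charP_cast_ne_zero K (p := p) (show 0 < 2 by norm_num) (by omega)
  have : 2 * finiteDilog (2 * h) (-1 : K) = 0 := by linear_combination -h1
  exact (mul_eq_zero.mp this).resolve_left h2

theorem harmonicSum_one_prime_sub_one (hp : p = 2 * h + 1) : harmonicSum K 1 (2 * h) = 0 := by
  have h3 := charP_two_mul_add_one K hp
  have h2 : (2 : K) ≠ 0 := by
    have := hpf.out.two_le
    exact_mod_cast charP_cast_ne_zero K (p := p) (show 0 < 2 by norm_num) (by omega)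
  have e : harmonicSum K 1 (2 * h) = -harmonicSum K 1 (2 * h) := by
    conv_lhs => rw [harmonicSum, ← sum_range_reflect]
    rw [harmonicSum, ← sum_neg_distrib]
    refine sum_congr rfl fun i hi => ?_
    simp only [mem_range] at hi
    have a2 : ((2 * h - 1 - i : ℕ) : K) + 1 = -(i + 1) := by
      rw [show 2 * h - 1 - i = 2 * h - (i + 1) by omega, Nat.cast_sub (by omega)]
      push_cast
      linear_combination h3
    rw [a2, pow_one, pow_one, inv_neg]
  have : 2 * harmonicSum K 1 (2 * h) = 0 := by linear_combination e
  exact (mul_eq_zero.mp this).resolve_left h2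

/-- Put N = p-1 in `sum_sum_one_sub_pow_div`, where C(p-1,k) ≡ (-1)^k, and exchange the sums using
H_{p-1} = 0. This is the finite analogue of the dilogarithm reflection formula. -/
theorem sum_pow_mul_harmonicSum (hp : p = 2 * h + 1) (hp3 : 3 < p) (v : K) :
    ∑ i ∈ range (2 * h), v ^ (i + 1) * harmonicSum K 1 (i + 1) / ((i : K) + 1)
      = finiteDilog (2 * h) v - finiteDilog (2 * h) (1 - v) := by
  have hN : ∀ k < 2 * h, (k : K) + 1 ≠ 0 := fun k hk => charP_cast_succ_ne_zero K (p := p) (by omega)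
  have key : ∀ u : K, ∑ i ∈ range (2 * h), (1 - u) ^ (i + 1) * harmonicSum K 1 i / ((i : K) + 1)
      - ∑ i ∈ range (2 * h), harmonicSum K 1 i / ((i : K) + 1) = -finiteDilog (2 * h) u := by
    intro u
    have h1 := sum_sum_one_sub_pow_div hN u
    have h2 : ∑ k ∈ range (2 * h), -(-u) ^ (k + 1) * (2 * h).choose (k + 1) / ((k : K) + 1) ^ 2
        = -finiteDilog (2 * h) u := by
      rw [finiteDilog, ← sum_neg_distrib]
      refine sum_congr rfl fun k hk => ?_
      simp only [mem_range] at hk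
      rw [cast_choose_two_mul hp (by omega), neg_mul, ← mul_pow]
      simp [neg_div]
    rw [← h2, ← h1]
    have h4 : ∀ N, ∑ m ∈ range N, 1 / ((m : K) + 1)
          * ∑ j ∈ range (m + 1), (1 - (1 - u) ^ (j + 1)) / ((j : K) + 1)
        = ∑ j ∈ range N, (1 - (1 - u) ^ (j + 1)) / ((j : K) + 1)
          * (harmonicSum K 1 N - harmonicSum K 1 j) := by
      intro N
      induction N with
      | zero => simp
      | succ N ih =>
        rw [sum_range_succ, ih, harmonicSum_succ, sum_range_succ _ N, sum_range_succ _ N, mul_add,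
          mul_sum, ← add_assoc, ← sum_add_distrib]
        congr 1
        · refine sum_congr rfl fun j _ => ?_
          rw [pow_one]; ring
        · rw [pow_one]; ring
    rw [h4, harmonicSum_one_prime_sub_one hp, ← sum_sub_distrib]
    refine sum_congr rfl fun j _ => ?_
    ring
  have k0 : ∑ i ∈ range (2 * h), harmonicSum K 1 i / ((i : K) + 1) = 0 := by
    have := key 1
    rw [finiteDilog_one hp hp3] at this
    simpa using this
  have k1 := key (1 - v)
  rw [k0, sub_sub_cancel, sub_zero] at k1
  rw [sub_eq_add_neg, ← k1, finiteDilog, ← sum_add_distrib]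
  refine sum_congr rfl fun i hi => ?_
  have := hN i (by simpa using hi)
  rw [harmonicSum_succ, pow_one]
  field_simp
  ring

/-! ### The square of the truncated inverse hyperbolic tangent -/

-- Such a polynomial has the form a + bX^p, and its values at 1 and -1 are a+b and a-b. Identities
-- of truncated series below are checked by differentiating and evaluating at these two points.
open Polynomial in
theorem eq_zero_of_derivative_eq_zero_of_natDegree_le (hp : p = 2 * h + 1) {f : K[X]}
    (hd : f.natDegree ≤ p) (hf : derivative f = 0) (h1 : f.eval 1 = 0) (h2 : f.eval (-1) = 0) :
    f = 0 := by
  have hc : ∀ k < 2 * h, f.coeff (k + 1) = 0 := by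
    intro k hk
    have := congrArg (fun g => coeff g k) hf
    simp only [coeff_derivative, coeff_zero] at this
    exact (mul_eq_zero.mp this).resolve_right (charP_cast_succ_ne_zero K (p := p) (by omega))
  have he : ∀ x : K, f.eval x = f.coeff 0 + f.coeff p * x ^ p := by
    intro x
    rw [eval_eq_sum_range' (show f.natDegree < p + 1 by omega), sum_range_succ, hp,
      sum_range_succ', sum_eq_zero fun k hk => by rw [hc k (by simpa using hk), zero_mul]]
    simp
  have hodd : Odd p := ⟨h, hp⟩
  rw [he, one_pow] at h1
  rw [he, hodd.neg_one_pow] at h2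
  have h3 : (2 : K) ≠ 0 := by
    have := hpf.out.two_le
    exact_mod_cast charP_cast_ne_zero K (p := p) (show 0 < 2 by norm_num) (by omega)
  have c0 : f.coeff 0 = 0 := by
    have : 2 * f.coeff 0 = 0 := by linear_combination h1 + h2
    exact (mul_eq_zero.mp this).resolve_left h3
  have cp : f.coeff p = 0 := by linear_combination h1 - c0
  ext k
  rw [coeff_zero]
  rcases lt_or_ge p k with hk | hk
  · exact coeff_eq_zero_of_natDegree_lt (by omega)
  · rcases k with _ | k
    · exact c0
    · rcases eq_or_lt_of_le hk with hk | hk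
      · rwa [hk]
      · exact hc k (by omega)

end FiniteDilogarithm

/-! ### Truncated artanh and artanh^2 at y = (1-X)/(1+X), cleared by (1+X)^p. -/

section ArtanhSquare

open Polynomial

variable {K : Type*} [Field K] {p h : ℕ} [CharP K p]

/-- `∑_{i<n} 1/(2i+1)`. -/
def oddHarmonicSum (K : Type*) [Field K] (n : ℕ) : K := ∑ i ∈ range n, 1 / (2 * (i : K) + 1)

theorem oddHarmonicSum_succ (K : Type*) [Field K] (n : ℕ) :
    oddHarmonicSum K (n + 1) = oddHarmonicSum K n + 1 / (2 * (n : K) + 1) := sum_range_succ _ _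

theorem natDegree_C_mul_one_sub_X_pow_mul_le (c : K) (a b : ℕ) :
    (C c * ((1 - X) ^ a * (1 + X) ^ b) : K[X]).natDegree ≤ a + b := by
  have h1 : (1 - X : K[X]).natDegree ≤ 1 := by compute_degree
  have h2 : (1 + X : K[X]).natDegree ≤ 1 := by compute_degree
  refine (natDegree_C_mul_le _ _).trans (natDegree_mul_le_of_le ?_ ?_)
  · simpa using natDegree_pow_le_of_le a h1
  · simpa using natDegree_pow_le_of_le b h2

/-- This is the derivative of y^{a+1} times the constant (1+X)^p: the exponents sum to p = 0 in K.
-/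
theorem derivative_one_sub_X_pow_mul {a b : ℕ} (hab : a + 1 + (b + 1) = p) :
    derivative ((1 - X) ^ (a + 1) * (1 + X) ^ (b + 1) : K[X])
      = C (-2 * ((a : K) + 1)) * ((1 - X) ^ a * (1 + X) ^ b) := by
  have h0 : ((a : K[X]) + 1 + (b + 1)) = 0 := by
    have : ((a + 1 + (b + 1) : ℕ) : K[X]) = 0 := by rw [hab]; exact CharP.cast_eq_zero K[X] p
    exact_mod_cast this
  simp only [derivative_mul, derivative_pow, derivative_sub, derivative_one,
    derivative_X, map_mul, map_neg, map_add, map_natCast, map_one, map_ofNat, Nat.cast_add,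
    Nat.cast_one, Nat.add_sub_cancel]
  linear_combination (1 - X) ^ (a + 1) * (1 + X) ^ b * h0

variable [hpf : Fact p.Prime]

theorem two_mul_sum_one_sub_X_pow (hp : p = 2 * h + 1) :
    (-2 : K[X]) * ∑ l ∈ range h, (1 - X) ^ (2 * l) * (1 + X) ^ (2 * h - 2 * l - 1)
      = ∑ i ∈ range (2 * h), X ^ i := by
  have : CharP K[X] p := inferInstance
  have h2 : (2 : K[X]) ≠ 0 := by
    have h2 : (2 : K) ≠ 0 := by
      have := hpf.out.two_le
      exact_mod_cast charP_cast_ne_zero K (p := p) (show 0 < 2 by norm_num) (by omega)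
    rw [← map_ofNat C]
    exact C_ne_zero.mpr h2
  have hX : (1 - X : K[X]) ≠ 0 := by
    rw [← neg_ne_zero, neg_sub]
    exact X_sub_C_ne_zero (1 : K)
  -- Both sides are geometric sums, in the squares of 1-X and 1+X with (1-X)^2 - (1+X)^2 = -4X, and
  -- in X. Frobenius identifies them once 2X(1-X) clears the denominators.
  apply mul_left_cancel₀ (mul_ne_zero (mul_ne_zero h2 (X_ne_zero (R := K))) hX)
  have e : ∑ l ∈ range h, (1 - X : K[X]) ^ (2 * l) * (1 + X) ^ (2 * h - 2 * l - 1)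
      = (1 + X) * ∑ l ∈ range h, ((1 - X) ^ 2) ^ l * ((1 + X) ^ 2) ^ (h - 1 - l) := by
    rw [mul_sum]
    refine sum_congr rfl fun l hl => ?_
    simp only [mem_range] at hl
    rw [← pow_mul, ← pow_mul, show 2 * h - 2 * l - 1 = 2 * (h - 1 - l) + 1 by omega, pow_succ]
    ring
  have g1 := (Commute.all ((1 - X : K[X]) ^ 2) ((1 + X) ^ 2)).mul_geom_sum₂ h
  have g2 := geom_sum_mul (X : K[X]) (2 * h)
  have f1 : (1 - X : K[X]) ^ p = 1 - X ^ p := by rw [sub_pow_char, one_pow]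
  have f2 : (1 + X : K[X]) ^ p = 1 + X ^ p := by rw [add_pow_char, one_pow]
  rw [e]
  rw [hp, pow_succ _ (2 * h), pow_mul _ 2 h] at f1 f2
  linear_combination X * 2 * g2 + (1 - X) * (1 + X) * g1 + (1 + X) * f1 - (1 - X) * f2

theorem eval_neg_one_sum_pow_div (hp : p = 2 * h + 1) :
    ∑ i ∈ range (2 * h), (-1 : K) ^ (i + 1) / ((i : K) + 1) = -2 * oddHarmonicSum K h := by
  have h0 := harmonicSum_one_prime_sub_one (K := K) hp
  rw [harmonicSum, sum_range_two_mul] at h0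
  rw [sum_range_two_mul, oddHarmonicSum]
  have e1 : ∑ j ∈ range h, (-1 : K) ^ (2 * j + 1) / (((2 * j : ℕ) : K) + 1)
      = -∑ j ∈ range h, 1 / (2 * (j : K) + 1) := by
    rw [← sum_neg_distrib]
    refine sum_congr rfl fun j _ => ?_
    rw [Odd.neg_one_pow ⟨j, rfl⟩]; push_cast; ring
  have e2 : ∑ j ∈ range h, (-1 : K) ^ (2 * j + 1 + 1) / (((2 * j + 1 : ℕ) : K) + 1)
      = ∑ j ∈ range h, ((((2 * j + 1 : ℕ) : K) + 1) ^ 1)⁻¹ := by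
    refine sum_congr rfl fun j _ => ?_
    rw [Even.neg_one_pow ⟨j + 1, by ring⟩, pow_one, one_div]
  have e3 : ∑ j ∈ range h, ((((2 * j : ℕ) : K) + 1) ^ 1)⁻¹ = ∑ j ∈ range h, 1 / (2 * (j : K) + 1) := by
    refine sum_congr rfl fun j _ => ?_
    rw [pow_one, one_div]; push_cast; rfl
  rw [e3] at h0
  rw [e1, e2]
  linear_combination h0

/-- A finite version of artanh y = -(log X)/2. The multiple of (1-X)^p has zero derivative and is
there to correct the value at -1. -/
theorem sum_one_sub_X_pow_div_odd (hp : p = 2 * h + 1) :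
    ∑ l ∈ range h, C (1 / (2 * (l : K) + 1)) * ((1 - X) ^ (2 * l + 1) * (1 + X) ^ (2 * h - 2 * l))
      - C (oddHarmonicSum K h) * (1 - X) ^ p
      = ∑ i ∈ range (2 * h), C (1 / ((i : K) + 1)) * X ^ (i + 1) := by
  have hodd : Odd p := ⟨h, hp⟩
  have hh : 0 < h := by have := hpf.out.two_le; omega
  rw [← sub_eq_zero]
  apply eq_zero_of_derivative_eq_zero_of_natDegree_le hp
  · refine (natDegree_sub_le_of_le (natDegree_sub_le_of_le (n := p) (m := p)
      (natDegree_sum_le_of_forall_le _ _ fun l hl => ?_) ?_) (n := p)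
      (natDegree_sum_le_of_forall_le _ _ fun i hi => ?_)).trans (by simp)
    · simp only [mem_range] at hl
      exact (natDegree_C_mul_one_sub_X_pow_mul_le _ _ _).trans (by omega)
    · simpa using natDegree_C_mul_one_sub_X_pow_mul_le (oddHarmonicSum K h) p 0
    · simp only [mem_range] at hi
      exact (natDegree_C_mul_X_pow_le _ _).trans (by omega)
  · have e1 : ∀ l ∈ range h, derivative (C (1 / (2 * (l : K) + 1))
          * ((1 - X) ^ (2 * l + 1) * (1 + X) ^ (2 * h - 2 * l)))
        = (-2 : K[X]) * ((1 - X) ^ (2 * l) * (1 + X) ^ (2 * h - 2 * l - 1)) := by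
      intro l hl
      simp only [mem_range] at hl
      have a1 : (2 * (l : K) + 1) ≠ 0 := by
        exact_mod_cast charP_cast_succ_ne_zero K (show 2 * l + 1 < p by omega)
      obtain ⟨b, hb⟩ : ∃ b, 2 * h - 2 * l = b + 1 := ⟨2 * h - 2 * l - 1, by omega⟩
      rw [hb, derivative_C_mul, derivative_one_sub_X_pow_mul (show 2 * l + 1 + (b + 1) = p by omega),
        ← mul_assoc, ← C_mul, Nat.add_sub_cancel]
      congr 1
      rw [show (-2 : K[X]) = C (-2) by rw [map_neg, map_ofNat]]
      congr 1
      push_cast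
      field_simp
    have e2 : ∀ i ∈ range (2 * h), derivative (C (1 / ((i : K) + 1)) * X ^ (i + 1)) = X ^ i := by
      intro i hi
      simp only [mem_range] at hi
      have a1 := charP_cast_succ_ne_zero K (show i + 1 < p by omega)
      rw [derivative_C_mul_X_pow, Nat.add_sub_cancel]
      push_cast
      rw [one_div_mul_cancel a1, C_1, one_mul]
    have e3 : derivative (C (oddHarmonicSum K h) * (1 - X) ^ p) = 0 := by
      rw [derivative_C_mul, derivative_pow, CharP.cast_eq_zero]; simp
    rw [derivative_sub, derivative_sub, derivative_sum, derivative_sum, sum_congr rfl e1,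
      sum_congr rfl e2, e3, ← mul_sum, two_mul_sum_one_sub_X_pow hp]
    simp
  · have h0 := harmonicSum_one_prime_sub_one (K := K) hp
    simp only [harmonicSum, pow_one] at h0
    simp [eval_finsetSum, hpf.out.ne_zero, h0]
  · have h0 := eval_neg_one_sum_pow_div (K := K) hp
    have h2 : (2 : K) ^ p = 2 := by
      have := add_pow_char (R := K) (p := p) 1 1
      rw [one_pow, one_add_one_eq_two] at this
      exact this
    have z : ∀ l ∈ range h, (1 / (2 * (l : K) + 1)) * ((1 - -1) ^ (2 * l + 1)
        * (1 + -1) ^ (2 * h - 2 * l)) = (0 : K) := by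
      intro l hl
      simp only [mem_range] at hl
      rw [add_neg_cancel, zero_pow (by omega)]; simp
    simp only [eval_sub, eval_finsetSum, eval_mul, eval_C, eval_pow, eval_one, eval_X, eval_add]
    rw [sum_eq_zero z, show (1 : K) - -1 = 2 by norm_num, h2]
    simp only [one_div_mul_eq_div]
    rw [h0]
    ring

/-- The coefficients are those of artanh(y)^2 = Σ O_{l+1} y^{2l+2}/(l+1), with O_n = Σ_{i<n}
1/(2i+1). Applying X d/dX and summing by parts reduces the identity to the truncated artanh. -/
theorem sum_oddHarmonicSum_mul_eq_neg_finiteDilog (hp : p = 2 * h + 1) (hp3 : 3 < p) (w : K) :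
    ∑ l ∈ range h, oddHarmonicSum K (l + 1) / ((l : K) + 1)
        * ((1 - w) ^ (2 * l + 2) * (1 + w) ^ (2 * h - 2 * l - 1))
      = -finiteDilog (2 * h) w := by
  have hh : 0 < h := by omega
  have key : ∑ l ∈ range h, C (oddHarmonicSum K (l + 1) / ((l : K) + 1))
        * ((1 - X) ^ (2 * l + 2) * (1 + X) ^ (2 * h - 2 * l - 1))
      + ∑ i ∈ range (2 * h), C (1 / ((i : K) + 1) ^ 2) * X ^ (i + 1) = 0 := by
    apply eq_zero_of_derivative_eq_zero_of_natDegree_le hp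
    · refine (natDegree_add_le_of_le (n := p) (m := p)
        (natDegree_sum_le_of_forall_le _ _ fun l hl => ?_)
        (natDegree_sum_le_of_forall_le _ _ fun i hi => ?_)).trans (by simp)
      · simp only [mem_range] at hl
        exact (natDegree_C_mul_one_sub_X_pow_mul_le _ _ _).trans (by omega)
      · simp only [mem_range] at hi
        exact (natDegree_C_mul_X_pow_le _ _).trans (by omega)
    · have e1 : ∀ l ∈ range h, X * derivative (C (oddHarmonicSum K (l + 1) / ((l : K) + 1))
            * ((1 - X) ^ (2 * l + 2) * (1 + X) ^ (2 * h - 2 * l - 1)))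
          = C (oddHarmonicSum K (l + 1)) * ((1 - X) ^ (2 * (l + 1) + 1) * (1 + X) ^ (2 * h - 2 * (l + 1))
              - (1 - X) ^ (2 * l + 1) * (1 + X) ^ (2 * h - 2 * l)) := by
        intro l hl
        simp only [mem_range] at hl
        have a1 := charP_cast_succ_ne_zero K (show l + 1 < p by omega)
        obtain ⟨b, hb⟩ : ∃ b, 2 * h - 2 * l = b + 2 := ⟨2 * h - 2 * l - 2, by omega⟩
        rw [show 2 * h - 2 * (l + 1) = b by omega, hb, show b + 2 - 1 = b + 1 by omega,
          derivative_C_mul, show 2 * l + 2 = 2 * l + 1 + 1 by ring,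
          derivative_one_sub_X_pow_mul (show 2 * l + 1 + 1 + (b + 1) = p by omega),
          ← mul_assoc (C _) (C _), ← C_mul]
        have e : oddHarmonicSum K (l + 1) / ((l : K) + 1) * (-2 * (((2 * l + 1 : ℕ) : K) + 1))
            = -4 * oddHarmonicSum K (l + 1) := by
          push_cast; field_simp; ring
        rw [e, C_mul, show (C (-4 : K)) = -4 by rw [map_neg, map_ofNat]]
        ring
      have e2 : ∀ i ∈ range (2 * h), X * derivative (C (1 / ((i : K) + 1) ^ 2) * X ^ (i + 1))
          = C (1 / ((i : K) + 1)) * X ^ (i + 1) := by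
        intro i hi
        simp only [mem_range] at hi
        have a1 := charP_cast_succ_ne_zero K (show i + 1 < p by omega)
        rw [derivative_C_mul_X_pow, Nat.add_sub_cancel, pow_succ X i]
        have : 1 / ((i : K) + 1) ^ 2 * ((i + 1 : ℕ) : K) = 1 / ((i : K) + 1) := by
          push_cast; field_simp
        rw [this]; ring
      have e3 : ∀ n, ∑ l ∈ range n, C (oddHarmonicSum K (l + 1))
            * ((1 - X) ^ (2 * (l + 1) + 1) * (1 + X) ^ (2 * h - 2 * (l + 1))
              - (1 - X) ^ (2 * l + 1) * (1 + X) ^ (2 * h - 2 * l))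
          = C (oddHarmonicSum K n) * ((1 - X) ^ (2 * n + 1) * (1 + X) ^ (2 * h - 2 * n))
            - ∑ l ∈ range n, C (1 / (2 * (l : K) + 1))
              * ((1 - X) ^ (2 * l + 1) * (1 + X) ^ (2 * h - 2 * l)) := by
        intro n
        induction n with
        | zero => simp [oddHarmonicSum]
        | succ n ih =>
          rw [sum_range_succ, ih, sum_range_succ, oddHarmonicSum_succ, C_add]
          ring
      apply (mul_eq_zero.mp _).resolve_left (X_ne_zero (R := K))
      rw [derivative_add, derivative_sum, derivative_sum, mul_add, mul_sum, mul_sum,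
        sum_congr rfl e1, sum_congr rfl e2, e3, ← sum_one_sub_X_pow_div_odd hp, Nat.sub_self,
        pow_zero, mul_one, ← hp]
      ring
    · have h0 := finiteDilog_one (K := K) hp hp3
      simp only [finiteDilog, one_pow] at h0
      simp only [eval_add, eval_finsetSum, eval_mul, eval_C, eval_pow, eval_sub, eval_one, eval_X,
        one_pow, mul_one]
      rw [h0]
      simp
    · have h0 := finiteDilog_neg_one (K := K) hp
      have z : ∀ l ∈ range h, oddHarmonicSum K (l + 1) / ((l : K) + 1) * ((1 - -1) ^ (2 * l + 2)
          * (1 + -1) ^ (2 * h - 2 * l - 1)) = (0 : K) := by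
        intro l hl
        simp only [mem_range] at hl
        rw [add_neg_cancel, zero_pow (by omega)]; simp
      simp only [eval_sub, eval_finsetSum, eval_mul, eval_C, eval_pow, eval_one, eval_X, eval_add]
      rw [sum_eq_zero z]
      simp only [one_div_mul_eq_div]
      rw [zero_add]
      exact h0
  have := congrArg (eval w) key
  simp only [eval_sub, eval_finsetSum, eval_mul, eval_C, eval_pow, eval_one, eval_X, eval_add,
    eval_zero, one_div_mul_eq_div] at this
  exact eq_neg_of_add_eq_zero_left this

end ArtanhSquare

/-! ### Evaluation at primitive cube roots of unity. -/

section CubeRoots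

variable {K : Type*} [Field K]

theorem cube_root_pow_prime {p : ℕ} [hpf : Fact p.Prime] (hp3 : 3 < p) {w : K} (hw : w ^ 2 + w + 1 = 0) :
    (w ^ p) ^ 2 + w ^ p + 1 = 0 := by
  have h3 : w ^ 3 = 1 := by linear_combination (w - 1) * hw
  have hn : p % 3 = 1 ∨ p % 3 = 2 := by
    have : ¬ 3 ∣ p := fun hd => by
      have := (Nat.prime_dvd_prime_iff_eq Nat.prime_three hpf.out).mp hd; omega
    omega
  obtain ⟨q, r, hr, hq⟩ : ∃ q r, (r = 1 ∨ r = 2) ∧ p = 3 * q + r := ⟨p / 3, p % 3, hn, by omega⟩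
  have e1 : w ^ p = w ^ r := by rw [hq, pow_add, pow_mul, h3, one_pow, one_mul]
  rw [e1]
  rcases hr with rfl | rfl
  · linear_combination hw
  · linear_combination hw + w * h3

variable {p h : ℕ} [CharP K p]

theorem sum_range_ite_three_dvd {R : Type*} [AddCommMonoid R] (f : ℕ → R) (N : ℕ) :
    ∑ i ∈ range N, (if 3 ∣ i + 1 then f (i + 1) else 0) = ∑ j ∈ range (N / 3), f (3 * (j + 1)) := by
  induction N with
  | zero => simp
  | succ N ih =>
    rw [sum_range_succ, ih, Nat.succ_div]
    split_ifs with hd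
    · rw [sum_range_succ]
      congr 2
      omega
    · simp

theorem chiThree_mul_sub {w : K} (hw : w ^ 2 + w + 1 = 0) (n : ℕ) :
    (chiThree n : K) * (w - w ^ 2) = w ^ n - w ^ (2 * n) := by
  have h3 : w ^ 3 = 1 := by linear_combination (w - 1) * hw
  obtain ⟨q, r, hr, rfl⟩ : ∃ q r, r < 3 ∧ n = 3 * q + r :=
    ⟨n / 3, n % 3, Nat.mod_lt _ (by norm_num), by omega⟩
  have e1 : w ^ (3 * q + r) = w ^ r := by rw [pow_add, pow_mul, h3, one_pow, one_mul]
  have e2 : w ^ (2 * (3 * q + r)) = w ^ (2 * r) := by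
    rw [show 2 * (3 * q + r) = 3 * (2 * q) + 2 * r by ring, pow_add, pow_mul, h3, one_pow, one_mul]
  rw [e1, e2]
  interval_cases r
  · simp [chiThree]
  · simp [chiThree, Nat.add_mod]
  · simp [chiThree, Nat.add_mod]
    linear_combination -w * h3

/-- Averaging over the cube roots keeps only indices divisible by 3, and L(1) = 0. -/
theorem finiteDilog_cube_roots (hp : p = 2 * h + 1) (hp3 : 3 < p) {w : K}
    (hw : w ^ 2 + w + 1 = 0) :
    finiteDilog (2 * h) w + finiteDilog (2 * h) (w ^ 2) = harmonicSum K 2 (2 * h / 3) / 3 := by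
  have h3 : w ^ 3 = 1 := by linear_combination (w - 1) * hw
  have n3 : (3 : K) ≠ 0 := by exact_mod_cast charP_cast_ne_zero K (p := p) (by norm_num) hp3
  have h1 := finiteDilog_one (K := K) hp hp3
  have e : finiteDilog (2 * h) (1 : K) + finiteDilog (2 * h) w + finiteDilog (2 * h) (w ^ 2)
      = ∑ i ∈ range (2 * h), (if 3 ∣ i + 1 then 3 / (((i + 1 : ℕ) : K)) ^ 2 else 0) := by
    simp only [finiteDilog]
    rw [← sum_add_distrib, ← sum_add_distrib]
    refine sum_congr rfl fun i _ => ?_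
    rw [← add_div, ← add_div]
    split_ifs with hd
    · obtain ⟨q, hq⟩ := hd
      rw [hq, ← pow_mul, show 2 * (3 * q) = 3 * (2 * q) by ring, pow_mul w 3 q,
        pow_mul w 3 (2 * q), h3, one_pow, one_pow, one_pow]
      congr 1
      · norm_num
      · rw [← hq]; push_cast; ring
    · obtain ⟨q, r, hr, hr0, hq⟩ : ∃ q r, r < 3 ∧ 0 < r ∧ i + 1 = 3 * q + r :=
        ⟨(i + 1) / 3, (i + 1) % 3, Nat.mod_lt _ (by norm_num), by omega, by omega⟩
      have e1 : w ^ (3 * q + r) = w ^ r := by rw [pow_add, pow_mul, h3, one_pow, one_mul]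
      rw [hq, ← pow_mul, mul_comm 2, pow_mul, e1, one_pow]
      have : 1 + w ^ r + (w ^ r) ^ 2 = 0 := by
        interval_cases r
        · linear_combination hw
        · linear_combination hw + w * h3
      rw [this, zero_div]
  rw [sum_range_ite_three_dvd (fun n => 3 / ((n : K)) ^ 2), h1, zero_add] at e
  rw [e, harmonicSum, sum_div]
  refine sum_congr rfl fun j hj => ?_
  simp only [mem_range] at hj
  have a1 := charP_cast_succ_ne_zero K (show j + 1 < p by omega)
  push_cast
  field_simp

theorem one_sub_cube_root_ne_zero (hp3 : 3 < p) {w : K} (hw : w ^ 2 + w + 1 = 0) : 1 - w ≠ 0 := by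
  intro h0
  have n3 : (3 : K) ≠ 0 := by exact_mod_cast charP_cast_ne_zero K (p := p) (by norm_num) hp3
  exact n3 (by linear_combination hw + (w + 2) * h0)

variable [hpf : Fact p.Prime]

/-- Inversion and the previous relation determine L(w) and L(w^2); duplication at -w then gives
L(-w). Keeping q = w^p as a symbol with q^2 + q + 1 = 0 treats both residues of p modulo 3 at once.
-/
theorem finiteDilog_neg_cube_root (hp : p = 2 * h + 1) (hp3 : 3 < p) {w : K}
    (hw : w ^ 2 + w + 1 = 0) :
    2 * (1 - w ^ p) * finiteDilog (2 * h) (-w) = -3 * w ^ p * (harmonicSum K 2 (2 * h / 3) / 3) ∧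
    finiteDilog (2 * h) (-w ^ 2) = -(w ^ p) ^ 2 * finiteDilog (2 * h) (-w) := by
  have h3 : w ^ 3 = 1 := by linear_combination (w - 1) * hw
  have hw0 : w ≠ 0 := by rintro rfl; simp at h3
  have hq := cube_root_pow_prime hp3 hw
  have hinv : w⁻¹ = w ^ 2 := by field_simp; linear_combination -h3
  have hodd : Odd p := ⟨h, hp⟩
  have c1 := finiteDilog_inv hp hw0
  rw [hinv] at c1
  have c2 := finiteDilog_inv hp (neg_ne_zero.mpr hw0)
  rw [hodd.neg_pow, inv_neg, hinv] at c2
  have c3 := finiteDilog_cube_roots hp hp3 hw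
  have c4 := finiteDilog_sq hp (-w)
  rw [hodd.neg_pow, neg_neg, neg_sq] at c4
  set q := w ^ p
  set S := harmonicSum K 2 (2 * h / 3) / 3
  set B := finiteDilog (2 * h) (w ^ 2)
  set A := finiteDilog (2 * h) w
  set D := finiteDilog (2 * h) (-w)
  have hB : B = -q * S := by
    linear_combination (-q) * c3 - q * c1 + B * hq
  constructor
  · rw [← c1] at c4
    linear_combination -c4 + 3 * hB - 2 * B * hq
  · linear_combination -(q ^ 2) * c2 - (q - 1) * finiteDilog (2 * h) (-w ^ 2) * hq

/-- Here χ(e) = (w^e - w^{2e})/(w - w^2), and v ↦ 1-v exchanges -w and -w^2, so only L(-w) - L(-w^2)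
is needed. -/
theorem sum_chiThree_mul_harmonicSum (hp : p = 2 * h + 1) (hp3 : 3 < p) {w : K}
    (hw : w ^ 2 + w + 1 = 0) :
    ∑ e ∈ Ico 1 p, (chiThree e : K) * (-1) ^ e * harmonicSum K 1 e / e
      = -(chiThree p * (harmonicSum K 2 (2 * h / 3) / 3)) := by
  have h3 : w ^ 3 = 1 := by linear_combination (w - 1) * hw
  have hw0 : w ≠ 0 := by rintro rfl; simp at h3
  have n1 := one_sub_cube_root_ne_zero hp3 hw
  have hq := cube_root_pow_prime hp3 hw
  have n2 := one_sub_cube_root_ne_zero hp3 hq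
  have hθ : w - w ^ 2 ≠ 0 := by
    rw [show w - w ^ 2 = w * (1 - w) by ring]; exact mul_ne_zero hw0 n1
  obtain ⟨d1, d2⟩ := finiteDilog_neg_cube_root hp hp3 hw
  have g1 := sum_pow_mul_harmonicSum hp hp3 (-w)
  have g2 := sum_pow_mul_harmonicSum hp hp3 (-w ^ 2)
  rw [show 1 - -w = -w ^ 2 by linear_combination hw] at g1
  rw [show 1 - -w ^ 2 = -w by linear_combination hw] at g2
  have hχ := chiThree_mul_sub hw p
  rw [mul_comm 2 p, pow_mul] at hχ
  have e : (∑ e ∈ Ico 1 p, (chiThree e : K) * (-1) ^ e * harmonicSum K 1 e / e) * (w - w ^ 2)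
      = ∑ i ∈ range (2 * h), (-w) ^ (i + 1) * harmonicSum K 1 (i + 1) / ((i : K) + 1)
        - ∑ i ∈ range (2 * h), (-w ^ 2) ^ (i + 1) * harmonicSum K 1 (i + 1) / ((i : K) + 1) := by
    rw [sum_Ico_eq_sum_range, show p - 1 = 2 * h by omega, sum_mul, ← sum_sub_distrib]
    refine sum_congr rfl fun i _ => ?_
    have := chiThree_mul_sub hw (1 + i)
    rw [neg_pow w, neg_pow (w ^ 2), ← pow_mul, add_comm i 1]
    rw [show ((1 + i : ℕ) : K) = (i : K) + 1 by push_cast; ring]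
    linear_combination (-1) ^ (1 + i) * harmonicSum K 1 (1 + i) / ((i : K) + 1) * this
  apply mul_right_cancel₀ hθ
  apply mul_left_cancel₀ n2
  rw [e, g1, g2, d2]
  set q := w ^ p
  set S := harmonicSum K 2 (2 * h / 3) / 3
  set D := finiteDilog (2 * h) (-w)
  linear_combination (1 + q ^ 2) * d1 + (1 - q) * S * hχ - 2 * S * q * hq

theorem sum_neg_three_pow_mul (hp : p = 2 * h + 1) (hp3 : 3 < p) {w : K}
    (hw : w ^ 2 + w + 1 = 0) :
    ∑ b ∈ range h, (-3 : K) ^ (h - 1 - b) / ((b : K) + 1) * ∑ j ∈ range (b + 1), 1 / ((h : K) - j)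
      = chiThree p * (harmonicSum K 2 (2 * h / 3) / 3) := by
  have h3 : w ^ 3 = 1 := by linear_combination (w - 1) * hw
  have hw0 : w ≠ 0 := by rintro rfl; simp at h3
  have n1 := one_sub_cube_root_ne_zero hp3 hw
  have hq := cube_root_pow_prime hp3 hw
  have n2 := one_sub_cube_root_ne_zero hp3 hq
  have hh := charP_two_mul_add_one K hp
  obtain ⟨d1, -⟩ := finiteDilog_neg_cube_root hp hp3 hw
  have g := sum_oddHarmonicSum_mul_eq_neg_finiteDilog hp hp3 (-w)
  have hχ := chiThree_mul_sub hw p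
  rw [mul_comm 2 p, pow_mul] at hχ
  have e : (1 - w) * w ^ h * ∑ b ∈ range h, (-3 : K) ^ (h - 1 - b) / ((b : K) + 1)
        * ∑ j ∈ range (b + 1), 1 / ((h : K) - j)
      = -2 * ∑ l ∈ range h, oddHarmonicSum K (l + 1) / ((l : K) + 1)
        * ((1 - -w) ^ (2 * l + 2) * (1 + -w) ^ (2 * h - 2 * l - 1)) := by
    rw [mul_sum, mul_sum]
    refine sum_congr rfl fun b hb => ?_
    simp only [mem_range] at hb
    have o : ∑ j ∈ range (b + 1), 1 / ((h : K) - j) = -2 * oddHarmonicSum K (b + 1) := by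
      rw [oddHarmonicSum, mul_sum]
      refine sum_congr rfl fun j hj => ?_
      simp only [mem_range] at hj
      have a1 : 2 * (j : K) + 1 ≠ 0 := by
        exact_mod_cast charP_cast_succ_ne_zero K (show 2 * j + 1 < p by omega)
      have a2 : (h : K) - j ≠ 0 := by
        have := charP_cast_ne_zero K (p := p) (k := h - j) (by omega) (by omega)
        rwa [Nat.cast_sub (by omega)] at this
      rw [mul_one_div, div_eq_div_iff a2 a1]
      linear_combination hh
    -- At the point -w the squares of 1-X and 1+X are w and -3w.
    have p1 : (1 - -w) ^ (2 * b + 2) = w ^ (b + 1) := by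
      rw [show 2 * b + 2 = 2 * (b + 1) by ring, pow_mul]
      congr 1
      linear_combination hw
    have p2 : (1 + -w) ^ (2 * h - 2 * b - 1) = (-3) ^ (h - 1 - b) * w ^ (h - 1 - b) * (1 - w) := by
      rw [show 2 * h - 2 * b - 1 = 2 * (h - 1 - b) + 1 by omega, pow_succ, pow_mul, ← mul_pow,
        ← sub_eq_add_neg]
      congr 2
      linear_combination hw
    have p3 : w ^ h = w ^ (b + 1) * w ^ (h - 1 - b) := by rw [← pow_add]; congr 1; omega
    rw [o, p1, p2, p3]
    ring
  rw [g] at e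
  have hqw : w ^ p * w ^ h = w := by
    rw [← pow_add, show p + h = 3 * h + 1 by omega, pow_succ, pow_mul, h3, one_pow, one_mul]
  apply mul_left_cancel₀ (mul_ne_zero n1 (pow_ne_zero h hw0))
  rw [e]
  apply mul_left_cancel₀ n2
  set q := w ^ p
  set S := harmonicSum K 2 (2 * h / 3) / 3
  set D := finiteDilog (2 * h) (-w)
  set E := w ^ h
  apply mul_left_cancel₀ hw0
  linear_combination w * d1 - (1 - q) * S * E * hχ
    - (1 - q) ^ 2 * S * hqw - w * S * hq

theorem exists_cube_root (p : ℕ) [Fact p.Prime] :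
    ∃ w : AlgebraicClosure (ZMod p), w ^ 2 + w + 1 = 0 := by
  have hd : (Polynomial.X ^ 2 + Polynomial.X + 1 :
      Polynomial (AlgebraicClosure (ZMod p))).degree = 2 := by compute_degree!
  obtain ⟨w, hw⟩ := IsAlgClosed.exists_root (Polynomial.X ^ 2 + Polynomial.X + 1 :
    Polynomial (AlgebraicClosure (ZMod p))) (by rw [hd]; norm_num)
  exact ⟨w, by simpa [Polynomial.IsRoot] using hw⟩

theorem map_harmonicSum {K L : Type*} [Field K] [Field L] (f : K →+* L) (r m : ℕ) :
    f (harmonicSum K r m) = harmonicSum L r m := by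
  simp [harmonicSum]

/-- In units of χσ/3 the character sum enters as 2·(-1) and the double sums as -3·(-2) - 3·1, for a
total of 1. `ZMod p` need not contain a cube root of unity, so the values are computed in its
algebraic closure. -/
theorem sum_alternating_aperyNumber_congrPow_harmonicSum (hp : p = 2 * h + 1) (hp3 : 3 < p) :
    ∃ S : ℤ, ∑ k ∈ range p, (-1 : ℤ) ^ k * (2 * k + 1) * aperyNumber k = p * S ∧
      CongrPow p 2 (S - chiThree p) (chiThree p * (harmonicSum (ZMod p) 2 (2 * h / 3) / 3)) := by
  obtain ⟨S, hS, hc⟩ := sum_alternating_aperyNumber_congrPow hp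
  refine ⟨S, hS, ?_⟩
  obtain ⟨e1, e2⟩ := sum_centralBinom_mul_sum_inv hp
  rw [e1, e2] at hc
  obtain ⟨w, hw⟩ := exists_cube_root p
  have : CharP (AlgebraicClosure (ZMod p)) p :=
    charP_of_injective_algebraMap (algebraMap (ZMod p) (AlgebraicClosure (ZMod p))).injective p
  have m1 : ∑ e ∈ Ico 1 p, (chiThree e : ZMod p) * (-1) ^ e * harmonicSum (ZMod p) 1 e / e
      = -(chiThree p * (harmonicSum (ZMod p) 2 (2 * h / 3) / 3)) := by
    apply (algebraMap (ZMod p) (AlgebraicClosure (ZMod p))).injective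
    have := sum_chiThree_mul_harmonicSum hp hp3 hw
    simpa [map_harmonicSum, map_ofNat] using this
  have m2 : ∑ b ∈ range h, (-3 : ZMod p) ^ (h - 1 - b) / ((b : ZMod p) + 1)
        * ∑ j ∈ range (b + 1), 1 / ((h : ZMod p) - j)
      = chiThree p * (harmonicSum (ZMod p) 2 (2 * h / 3) / 3) := by
    apply (algebraMap (ZMod p) (AlgebraicClosure (ZMod p))).injective
    have := sum_neg_three_pow_mul hp hp3 hw
    simpa [map_harmonicSum, map_ofNat] using this
  rw [m1, m2] at hc
  convert hc using 1
  ring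

end CubeRoots

/-! ### Reduction of p-integral rationals and the Bernoulli value. -/

section PIntegralReduction

/-- The rational number `x` is `p`-integral and reduces to `r` modulo `p`. -/
def PReduces (p : ℕ) [Fact p.Prime] (x : ℚ) (r : ZMod p) : Prop := PIntegral p x ∧ (x : ZMod p) = r

variable {p : ℕ} [hpf : Fact p.Prime]

theorem pIntegral_iff {x : ℚ} : PIntegral p x ↔ (x.den : ZMod p) ≠ 0 := by
  rw [PIntegral, ne_eq, ZMod.natCast_eq_zero_iff]

namespace PReduces

variable {x y : ℚ} {r s : ZMod p}

theorem add (hx : PReduces p x r) (hy : PReduces p y s) : PReduces p (x + y) (r + s) := by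
  refine ⟨fun h => ?_, ?_⟩
  · rcases hpf.out.dvd_mul.mp (h.trans (Rat.add_den_dvd x y)) with h | h
    exacts [hx.1 h, hy.1 h]
  · rw [Rat.cast_add_of_ne_zero (pIntegral_iff.mp hx.1) (pIntegral_iff.mp hy.1), hx.2, hy.2]

theorem mul (hx : PReduces p x r) (hy : PReduces p y s) : PReduces p (x * y) (r * s) := by
  refine ⟨fun h => ?_, ?_⟩
  · rcases hpf.out.dvd_mul.mp (h.trans (Rat.mul_den_dvd x y)) with h | h
    exacts [hx.1 h, hy.1 h]
  · rw [Rat.cast_mul_of_ne_zero (pIntegral_iff.mp hx.1) (pIntegral_iff.mp hy.1), hx.2, hy.2]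

theorem intCast (z : ℤ) : PReduces p z z :=
  ⟨by simp [PIntegral, hpf.out.one_lt.ne'], by simp⟩

theorem natCast (n : ℕ) : PReduces p n n := by exact_mod_cast intCast (p := p) n

theorem neg (hx : PReduces p x r) : PReduces p (-x) (-r) := by
  have := (intCast (p := p) (-1)).mul hx
  push_cast at this
  rwa [neg_one_mul, neg_one_mul] at this

theorem sub (hx : PReduces p x r) (hy : PReduces p y s) : PReduces p (x - y) (r - s) := by
  rw [sub_eq_add_neg, sub_eq_add_neg]; exact hx.add hy.neg

theorem pow (hx : PReduces p x r) (n : ℕ) : PReduces p (x ^ n) (r ^ n) := by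
  induction n with
  | zero => simpa using natCast (p := p) 1
  | succ n ih => rw [pow_succ, pow_succ]; exact ih.mul hx

theorem sum {ι : Type*} {s : Finset ι} {f : ι → ℚ} {g : ι → ZMod p}
    (h : ∀ i ∈ s, PReduces p (f i) (g i)) : PReduces p (∑ i ∈ s, f i) (∑ i ∈ s, g i) := by
  classical
  induction s using Finset.induction_on with
  | empty => simpa using natCast (p := p) 0
  | insert i s hi ih =>
    rw [sum_insert hi, sum_insert hi]
    exact (h i (mem_insert_self i s)).add (ih fun j hj => h j (mem_insert_of_mem hj))

theorem inv_natCast {n : ℕ} (hn : (n : ZMod p) ≠ 0) : PReduces p (n : ℚ)⁻¹ (n : ZMod p)⁻¹ := by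
  have h0 : 0 < n := Nat.pos_of_ne_zero fun h => hn (by simp [h])
  refine ⟨?_, ?_⟩
  · rw [pIntegral_iff, Rat.inv_natCast_den_of_pos h0]; exact hn
  · rw [Rat.cast_inv_of_ne_zero (by simpa using hn)]; simp

end PReduces

theorem PIntegral.preduces {x : ℚ} (hx : PIntegral p x) : PReduces p x x := ⟨hx, rfl⟩

theorem PReduces.exists_eq_mul {x : ℚ} (hx : PReduces p x 0) :
    ∃ c, PIntegral p c ∧ x = p * c := by
  have hd := pIntegral_iff.mp hx.1
  have h1 := hx.2
  rw [Rat.cast_def, div_eq_zero_iff, or_iff_left hd, ZMod.intCast_zmod_eq_zero_iff_dvd] at h1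
  obtain ⟨z, hz⟩ := h1
  refine ⟨z * (x.den : ℚ)⁻¹, ((PReduces.intCast z).mul (PReduces.inv_natCast hd)).1, ?_⟩
  rw [← mul_assoc, ← div_eq_mul_inv]
  conv_lhs => rw [← Rat.num_div_den x, hz]
  push_cast
  rfl

/-- The recursion divides only by integers from 2 to n+1, all below p. -/
theorem pIntegral_bernoulli' {n : ℕ} (hn : n + 1 < p) : PIntegral p (bernoulli' n) := by
  induction n using Nat.strong_induction_on with
  | _ n ih =>
    rw [bernoulli'_def]
    have h1 : PReduces p (∑ k ∈ range n, (n.choose k : ℚ) / (n - k + 1) * bernoulli' k)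
        (∑ k ∈ range n, (n.choose k : ZMod p) * ((n - k + 1 : ℕ) : ZMod p)⁻¹
          * ((bernoulli' k : ℚ) : ZMod p)) := by
      refine PReduces.sum fun k hk => ?_
      simp only [mem_range] at hk
      have e : (n.choose k : ℚ) / (n - k + 1) = (n.choose k : ℚ) * ((n - k + 1 : ℕ) : ℚ)⁻¹ := by
        push_cast [Nat.cast_sub hk.le]; rfl
      rw [e]
      exact ((PReduces.natCast _).mul (PReduces.inv_natCast
        (cast_ne_zero_of_lt (by omega) (by omega)))).mul (ih k hk (by omega)).preduces
    have h0 := PReduces.natCast (p := p) 1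
    rw [Nat.cast_one] at h0
    exact (h0.sub h1).1

theorem pIntegral_bernoulli {n : ℕ} (hn : n + 1 < p) : PIntegral p (bernoulli n) := by
  have h0 := ((PReduces.intCast (p := p) (-1)).pow n).mul (pIntegral_bernoulli' hn).preduces
  rw [bernoulli]
  push_cast at h0
  exact h0.1

theorem preduces_bernoulli_eval {n : ℕ} (hn : n + 1 < p) {x : ℚ} {r : ZMod p}
    (hx : PReduces p x r) :
    PReduces p ((Polynomial.bernoulli n).eval x)
      (∑ i ∈ range (n + 1), ((bernoulli i : ℚ) : ZMod p) * n.choose i * r ^ (n - i)) := by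
  rw [Polynomial.bernoulli, Polynomial.eval_finsetSum]
  refine PReduces.sum fun i hi => ?_
  simp only [mem_range] at hi
  rw [Polynomial.eval_monomial]
  exact ((pIntegral_bernoulli (by omega)).preduces.mul (PReduces.natCast _)).mul (hx.pow _)

/-- By Fermat, σ is the sum of k^{p-3} over k ≤ q = ⌊(p-1)/3⌋, so Faulhaber's formula and B_{p-2} =
0 give B_{p-2}(q+1) ≡ -2σ. Modulo p the point q+1 is 2/3 or 1/3 according as p is 1 or 2 modulo 3,
and B_{p-2}(2/3) = -B_{p-2}(1/3). -/
theorem preduces_bernoulli_eval_one_third {h : ℕ} (hp : p = 2 * h + 1) (hp3 : 3 < p) :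
    PReduces p ((Polynomial.bernoulli (p - 2)).eval (1 / 3 : ℚ))
      (2 * chiThree p * harmonicSum (ZMod p) 2 (2 * h / 3)) := by
  have hodd : Odd (p - 2) := ⟨h - 1, by omega⟩
  have n3 : ((3 : ℕ) : ZMod p) ≠ 0 := cast_ne_zero_of_lt (by norm_num) hp3
  have n3' : (3 : ZMod p) ≠ 0 := by exact_mod_cast n3
  set q := 2 * h / 3
  set σ := harmonicSum (ZMod p) 2 q
  have hcases : p = 3 * q + 1 ∨ p = 3 * q + 2 := by
    have : ¬ 3 ∣ p := fun hd => by
      have := (Nat.prime_dvd_prime_iff_eq Nat.prime_three hpf.out).mp hd; omega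
    omega
  have hsum := Polynomial.sum_range_pow_eq_bernoulli_sub (q + 1) (p - 3)
  rw [show (p - 3).succ = p - 2 by omega, bernoulli_eq_zero_of_odd hodd (by omega), sub_zero] at hsum
  have hint : PReduces p ((((p - 3 : ℕ) : ℚ) + 1) * ∑ k ∈ range (q + 1), (k : ℚ) ^ (p - 3))
      (-2 * σ) := by
    have h1 := PReduces.natCast (p := p) ((p - 3 + 1) * ∑ k ∈ range (q + 1), k ^ (p - 3))
    push_cast at h1
    convert h1 using 1
    rw [Nat.cast_sub (by omega), sum_range_succ', CharP.cast_eq_zero]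
    simp only [Nat.cast_zero, zero_pow (show p - 3 ≠ 0 by omega), add_zero]
    push_cast
    rw [show (0 - 3 + 1 : ZMod p) = -2 by norm_num]
    congr 1
    refine sum_congr rfl fun j hj => ?_
    simp only [mem_range] at hj
    have hj0 : (j : ZMod p) + 1 ≠ 0 := cast_succ_ne_zero_of_lt (by omega)
    have := ZMod.pow_card_sub_one_eq_one hj0
    rw [show p - 1 = p - 3 + 2 by omega, pow_add] at this
    exact (eq_inv_of_mul_eq_one_left this).symm
  rw [hsum] at hint
  have hβ := hint.2.symm.trans
    (preduces_bernoulli_eval (n := p - 2) (by omega) (PReduces.natCast (q + 1))).2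
  have third : PReduces p (1 / 3 : ℚ) (3 : ZMod p)⁻¹ := by
    have := PReduces.inv_natCast n3
    push_cast at this
    rwa [one_div]
  have hp0 : (p : ZMod p) = 0 := CharP.cast_eq_zero _ _
  rcases hcases with hq | hq
  · have hq' : 3 * (q : ZMod p) + 1 = 0 := by
      have h' : (p : ZMod p) = ((3 * q + 1 : ℕ) : ZMod p) := congrArg Nat.cast hq
      rw [hp0] at h'
      push_cast at h'
      exact h'.symm
    have hχ : chiThree p = 1 := by
      rw [chiThree, if_pos (by omega)]
    have two_third : PReduces p (1 - 1 / 3 : ℚ) ((q + 1 : ℕ) : ZMod p) := by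
      have := (PReduces.natCast (p := p) 1).sub third
      convert this using 1
      · simp
      · push_cast; field_simp; linear_combination hq'
    have h1 := preduces_bernoulli_eval (n := p - 2) (by omega) two_third
    rw [← hβ, Polynomial.bernoulli_eval_one_sub, hodd.neg_one_pow, neg_one_mul] at h1
    have h2 := h1.neg
    rw [neg_neg] at h2
    rw [hχ]
    convert h2 using 1
    push_cast; ring
  · have hq' : 3 * (q : ZMod p) + 2 = 0 := by
      have h' : (p : ZMod p) = ((3 * q + 2 : ℕ) : ZMod p) := congrArg Nat.cast hq
      rw [hp0] at h'
      push_cast at h'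
      exact h'.symm
    have hχ : chiThree p = -1 := by
      rw [chiThree, if_neg (by omega), if_pos (by omega)]
    have e : (3 : ZMod p)⁻¹ = ((q + 1 : ℕ) : ZMod p) := by
      push_cast; field_simp; linear_combination -hq'
    rw [e] at third
    have h1 := preduces_bernoulli_eval (n := p - 2) (by omega) third
    rw [← hβ] at h1
    rw [hχ]
    convert h1 using 1
    push_cast; ring

end PIntegralReduction

theorem theorem1p1 (p : ℕ) (hp : p.Prime) (hp3 : 3 < p) :
    PIntegralCongr p 3
      ((1 / (p : ℚ)) *
        ∑ k ∈ Finset.range p, (-1 : ℚ) ^ k * (2 * (k : ℚ) + 1) * (aperyNumber k : ℚ))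
      ((legendreSym 3 (p : ℤ) : ℚ) +
        (p : ℚ) ^ 2 / 6 * (Polynomial.bernoulli (p - 2)).eval (1 / 3 : ℚ)) := by
  have : Fact p.Prime := ⟨hp⟩
  obtain ⟨h, hh⟩ := hp.odd_of_ne_two (by omega)
  have hp0 : (p : ℚ) ≠ 0 := by exact_mod_cast hp.ne_zero
  obtain ⟨S, hS, e, he, hc⟩ := sum_alternating_aperyNumber_congrPow_harmonicSum hh hp3
  have hb := preduces_bernoulli_eval_one_third hh hp3
  set b := (Polynomial.bernoulli (p - 2)).eval (1 / 3 : ℚ)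
  have hSq : (1 / (p : ℚ)) * ∑ k ∈ range p, (-1 : ℚ) ^ k * (2 * (k : ℚ) + 1) * (aperyNumber k : ℚ)
      = S := by
    have : ∑ k ∈ range p, (-1 : ℚ) ^ k * (2 * (k : ℚ) + 1) * (aperyNumber k : ℚ) = p * S := by
      exact_mod_cast hS
    rw [this]; field_simp
  have n2 : (2 : ZMod p) ≠ 0 := two_ne_zero_of_odd hh
  have n3 : (3 : ZMod p) ≠ 0 := by exact_mod_cast cast_ne_zero_of_lt (p := p) (by norm_num) hp3
  have n6 : ((6 : ℕ) : ZMod p) ≠ 0 := by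
    have : ((6 : ℕ) : ZMod p) = 2 * 3 := by norm_num
    rw [this]; exact mul_ne_zero n2 n3
  have h6 := PReduces.inv_natCast n6
  rw [hSq, legendreSym_three_eq_chiThree]
  have hr : PReduces p ((e : ℚ) - ((6 : ℕ) : ℚ)⁻¹ * b) 0 := by
    have := (PReduces.intCast (p := p) e).sub (h6.mul hb)
    rw [hc] at this
    convert this using 1
    have : ((6 : ℕ) : ZMod p) = 2 * 3 := by norm_num
    rw [this]
    field_simp
    ring
  obtain ⟨c, hcI, hce⟩ := hr.exists_eq_mul
  refine ⟨(PReduces.intCast S).1, ?_, c, hcI, ?_⟩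
  · have := (PReduces.intCast (p := p) (chiThree p)).add
      ((((PReduces.natCast (p := p) p).pow 2).mul h6).mul hb)
    exact this.1
  · have he' : (S : ℚ) - chiThree p = (p : ℚ) ^ 2 * e := by exact_mod_cast he
    push_cast at hce
    linear_combination he' + (p : ℚ) ^ 2 * hce
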